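/- Let $k$ be a field, $H$ a Hopf algebra over $k$ and $R$ an associative unital $k$-algebra. Let $H$ act weakly on $R$ (a bilinear action with $1\cdot r=r$, $h\cdot 1=\varepsilon(h)1$, $h\cdot(ab)=\sum (h_1\cdot a)(h_2\cdot b)$) and let $\sigma\colon H\otimes H\to R$ be a convolution-invertible linear map such that $R$ is a twisted $H$-module, $h\cdot(l\cdot r)=\sum\sigma(h_1,l_1)(h_2l_2\cdot r)\sigma^{-1}(h_3,l_3)$, and $\sigma$ is a normalized cocycle, $\sigma(h,1)=\sigma(1,h)=\varepsilon(h)1$ and $\sum (h_1\cdot\sigma(l_1,m_1))\,\sigma(h_2,l_2m_2)=\sum\sigma(h_1,l_1)\,\sigma(h_2l_2,m)$. Let $R\#_\sigma H$ be the crossed product: the space $R\otimes H$, with $a\# h:=a\otimes h$, with the associative multiplication $(a\# h)(b\# l)=\sum a(h_1\cdot b)\sigma(h_2,l_1)\# h_3l_2$ and identity $1\#1$; identify $R$ with $R\#1$. For a ring $A$ let $r_j(A)$ denote its Jacobson radical, and put $$r_{Hj}(R)=r_j(R\#_\sigma H)\cap R,\qquad r_{jH}(R)=(r_j(R):H)=\{r\in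 R : h\cdot r\in r_j(R)\ \text{for all } h\in H\}.$$ Suppose that $H$ is semisimple (as a ring), cosemisimple (the sum of its simple subcoalgebras), and commutative or cocommutative. Suppose that there is an algebraic closure $F$ of $k$ such that $$r_j(R\otimes_k F)=r_j(R)\otimes_k F\quad\text{and}\quad r_j\big((R\#_\sigma H)\otimes_k F\big)=r_j(R\#_\sigma H)\otimes_k F .$$ Then (1) $r_j(R)=r_{Hj}(R)=r_{jH}(R)$; (2) $r_j(R\#_\sigma H)=r_{Hj}(R)\#_\sigma H$, where $I\#_\sigma H$ denotes the image of $I\otimes H$ in $R\otimes H$. -/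

import Mathlib

open scoped TensorProduct
open WithConv

noncomputable section

/-! ### Cosemisimple coalgebras -/

section Cosemisimple

variable (k : Type*) {C : Type*} [Field k] [AddCommGroup C] [Module k C] [Coalgebra k C]

/-- A subspace `D` of a coalgebra is a subcoalgebra if `Δ(D) ⊆ D ⊗ D`. -/
def IsSubcoalgebra (D : Submodule k C) : Prop :=
  ∀ x ∈ D, Coalgebra.comul (R := k) x ∈ LinearMap.range (TensorProduct.map D.subtype D.subtype)

/-- A nonzero subcoalgebra with no subcoalgebras other than zero and itself. -/
def IsSimpleSubcoalgebra (D : Submodule k C) : Prop :=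
  IsSubcoalgebra k D ∧ D ≠ ⊥ ∧ ∀ E : Submodule k C, IsSubcoalgebra k E → E ≤ D → E = ⊥ ∨ E = D

variable (C) in
/-- A coalgebra is cosemisimple if it is the sum of its simple subcoalgebras,
that is, if it equals its coradical. -/
def IsCosemisimpleCoalgebra : Prop :=
  sSup {D : Submodule k C | IsSimpleSubcoalgebra k D} = ⊤

end Cosemisimple

/-! ### Crossed systems -/

/-- The data that define a crossed product `R #_σ H`: a weak action of the Hopf algebra `H` on the
algebra `R` and a convolution-invertible map `σ : H ⊗ H → R` such that `R` is a twisted `H`-module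
and `σ` is a normalized 2-cocycle.  Products of elements `toConv f` are convolution products,
`(f * g)(c) = ∑ f(c₁) g(c₂)`, where `H ⊗ H` and `H ⊗ (H ⊗ H)` carry the tensor product coalgebra
structures. -/
structure CrossedSystem (k H R : Type*) [Field k] [Ring H] [HopfAlgebra k H] [Ring R]
    [Algebra k R] where
  /-- the weak action, `act h r = h · r` -/
  act : H →ₗ[k] R →ₗ[k] R
  /-- the convolution-invertible map `σ` -/
  σ : (WithConv (H ⊗[k] H →ₗ[k] R))ˣ
  /-- `1 · r = r` -/
  one_act : ∀ r, act 1 r = r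
  /-- `h · 1 = ε(h) 1` -/
  act_one : ∀ h, act h 1 = algebraMap k R (Coalgebra.counit h)
  /-- `h · (a b) = ∑ (h₁ · a) (h₂ · b)` -/
  act_mul : ∀ h a b,
    act h (a * b) = LinearMap.mul' k R
      (TensorProduct.map (act.flip a) (act.flip b) (Coalgebra.comul h))
  /-- `h · (l · r) = ∑ σ(h₁, l₁) (h₂ l₂ · r) σ⁻¹(h₃, l₃)` -/
  twisted : ∀ r,
    toConv (TensorProduct.lift (act.compl₂ (act.flip r))) =
      (σ : WithConv (H ⊗[k] H →ₗ[k] R)) * toConv (act.flip r ∘ₗ LinearMap.mul' k H) *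
        (σ⁻¹ : (WithConv (H ⊗[k] H →ₗ[k] R))ˣ)
  /-- `σ(h, 1) = ε(h) 1` -/
  σ_one_right : ∀ h, σ.val.ofConv (h ⊗ₜ 1) = algebraMap k R (Coalgebra.counit h)
  /-- `σ(1, h) = ε(h) 1` -/
  σ_one_left : ∀ h, σ.val.ofConv (1 ⊗ₜ h) = algebraMap k R (Coalgebra.counit h)
  /-- `∑ (h₁ · σ(l₁, m₁)) σ(h₂, l₂ m₂) = ∑ σ(h₁, l₁) σ(h₂ l₂, m)`, as an identity of maps
  `h ⊗ (l ⊗ m) ↦ _`; the first factor on the right is `h ⊗ (l ⊗ m) ↦ σ(h, l) ε(m)`. -/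
  cocycle :
    toConv (TensorProduct.lift (act.compl₂ σ.val.ofConv)) *
        toConv (σ.val.ofConv ∘ₗ LinearMap.lTensor H (LinearMap.mul' k H)) =
      toConv (TensorProduct.rid k R ∘ₗ TensorProduct.map σ.val.ofConv Coalgebra.counit ∘ₗ
          (TensorProduct.assoc k H H H).symm.toLinearMap) *
        toConv (σ.val.ofConv ∘ₗ LinearMap.rTensor H (LinearMap.mul' k H) ∘ₗ
          (TensorProduct.assoc k H H H).symm.toLinearMap)

namespace CrossedSystem

variable {k H R : Type*} [Field k] [Ring H] [HopfAlgebra k H] [Ring R] [Algebra k R]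

/-- `a ↦ a ⊗ 1`, as an algebra map into the tensor product algebra `R ⊗ H`. -/
def inl (k R H : Type*) [Field k] [Ring H] [HopfAlgebra k H] [Ring R] [Algebra k R] :
    R →ₐ[k] R ⊗[k] H := Algebra.TensorProduct.includeLeft

/-- `h ↦ 1 ⊗ h`, as an algebra map into the tensor product algebra `R ⊗ H`. -/
def inr (k R H : Type*) [Field k] [Ring H] [HopfAlgebra k H] [Ring R] [Algebra k R] :
    H →ₐ[k] R ⊗[k] H := Algebra.TensorProduct.includeRight

variable (D : CrossedSystem k H R)

/-- `h ⊗ l ↦ ε(l) (h · b)`. -/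
def actLeft (b : R) : H ⊗[k] H →ₗ[k] R :=
  TensorProduct.rid k R ∘ₗ TensorProduct.map (D.act.flip b) Coalgebra.counit

/-- The map `h ⊗ l ↦ ∑ (h₁ · b) σ(h₂, l₁) ⊗ h₃ l₂`, written as a convolution product of three maps
into the tensor product algebra `R ⊗ H`. -/
def twist : R →ₗ[k] H ⊗[k] H →ₗ[k] R ⊗[k] H where
  toFun b := (toConv ((inl k R H).toLinearMap ∘ₗ D.actLeft b) *
    toConv ((inl k R H).toLinearMap ∘ₗ D.σ.val.ofConv) *
    toConv ((inr k R H).toLinearMap ∘ₗ LinearMap.mul' k H)).ofConv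
  map_add' b c := by
    have : D.actLeft (b + c) = D.actLeft b + D.actLeft c := by
      ext; simp [actLeft]
    simp [this, LinearMap.comp_add, add_mul]
  map_smul' r b := by
    have : D.actLeft (r • b) = r • D.actLeft b := by
      ext h l
      simp only [actLeft, TensorProduct.AlgebraTensorModule.curry_apply, TensorProduct.curry_apply,
        LinearMap.restrictScalars_self, LinearMap.comp_apply, LinearMap.smul_apply,
        TensorProduct.map_smul_left, map_smul]
    simp [this, LinearMap.comp_smul]

/-- The multiplication of the crossed product,
`(a # h) (b # l) = ∑ a (h₁ · b) σ(h₂, l₁) # h₃ l₂`. -/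
def mulMap : R ⊗[k] H →ₗ[k] R ⊗[k] H →ₗ[k] R ⊗[k] H :=
  TensorProduct.lift <| LinearMap.mk₂ k
    (fun a h => TensorProduct.lift <| LinearMap.mk₂ k
      (fun b l => a ⊗ₜ[k] (1 : H) * D.twist b (h ⊗ₜ l))
      (fun _ _ _ => by simp [mul_add]) (fun _ _ _ => by simp)
      (fun _ _ _ => by simp [TensorProduct.tmul_add, mul_add]) (fun _ _ _ => by simp))
    (fun _ _ _ => by ext; simp [TensorProduct.add_tmul, add_mul])
    (fun r a h => by
      ext b l
      simp only [TensorProduct.AlgebraTensorModule.curry_apply, TensorProduct.curry_apply,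
        LinearMap.restrictScalars_self, TensorProduct.lift.tmul, LinearMap.mk₂_apply,
        LinearMap.smul_apply, ← TensorProduct.smul_tmul', smul_mul_assoc])
    (fun _ _ _ => by ext; simp [TensorProduct.add_tmul, mul_add])
    (fun r h l => by
      ext b m
      simp only [TensorProduct.AlgebraTensorModule.curry_apply, TensorProduct.curry_apply,
        LinearMap.restrictScalars_self, TensorProduct.lift.tmul, LinearMap.mk₂_apply,
        LinearMap.smul_apply, TensorProduct.smul_tmul, TensorProduct.tmul_smul, map_smul,
        mul_smul_comm])

lemma mulMap_tmul (a b : R) (h l : H) :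
    D.mulMap (a ⊗ₜ h) (b ⊗ₜ l) = a ⊗ₜ[k] (1 : H) * D.twist b (h ⊗ₜ l) := rfl

section Assoc

open Coalgebra

lemma conv_tmul {C E A : Type*} [AddCommGroup C] [Module k C] [Coalgebra k C] [AddCommGroup E]
    [Module k E] [Coalgebra k E] [Ring A] [Algebra k A]
    (f g : WithConv (C ⊗[k] E →ₗ[k] A)) (c : C) (d : E) :
    (f * g).ofConv (c ⊗ₜ d) = ∑ i ∈ (ℛ k c).index, ∑ j ∈ (ℛ k d).index,
      f.ofConv ((ℛ k c).left i ⊗ₜ (ℛ k d).left j) *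
        g.ofConv ((ℛ k c).right i ⊗ₜ (ℛ k d).right j) := by
  rw [LinearMap.convMul_def]
  simp only [LinearMap.comp_apply, TensorProduct.comul_tmul]
  rw [← (ℛ k c).eq, ← (ℛ k d).eq]
  simp only [TensorProduct.sum_tmul, TensorProduct.tmul_sum, map_sum,
    TensorProduct.AlgebraTensorModule.tensorTensorTensorComm_tmul, TensorProduct.map_tmul,
    LinearMap.mul'_apply]
  exact Finset.sum_comm

lemma comp_conv {C A B : Type*} [AddCommGroup C] [Module k C] [Coalgebra k C] [Ring A]
    [Algebra k A] [Ring B] [Algebra k B] (φ : A →ₐ[k] B) (f g : WithConv (C →ₗ[k] A)) :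
    toConv (φ.toLinearMap ∘ₗ (f * g).ofConv) =
      toConv (φ.toLinearMap ∘ₗ f.ofConv) * toConv (φ.toLinearMap ∘ₗ g.ofConv) :=
  congrArg toConv (LinearMap.algHom_comp_convMul_distrib φ f g)

lemma conv_comp {C E A : Type*} [AddCommGroup C] [Module k C] [Coalgebra k C] [AddCommGroup E]
    [Module k E] [Coalgebra k E] [Ring A] [Algebra k A] (π : E →ₗc[k] C)
    (f g : WithConv (C →ₗ[k] A)) :
    toConv ((f * g).ofConv ∘ₗ π.toLinearMap) =
      toConv (f.ofConv ∘ₗ π.toLinearMap) * toConv (g.ofConv ∘ₗ π.toLinearMap) :=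
  congrArg toConv (LinearMap.convMul_comp_coalgHom_distrib f g π)

/-- The projection `c ⊗ d ↦ ε(d) c`, as a coalgebra map. -/
def proj (k C E : Type*) [Field k] [AddCommGroup C] [Module k C] [Coalgebra k C] [AddCommGroup E]
    [Module k E] [Coalgebra k E] : C ⊗[k] E →ₗc[k] C :=
  (Coalgebra.TensorProduct.rid k k C).toCoalgHom.comp
    (Coalgebra.TensorProduct.map (CoalgHom.id k C) (counitCoalgHom k E))

lemma proj_tmul {C E : Type*} [AddCommGroup C] [Module k C] [Coalgebra k C] [AddCommGroup E]
    [Module k E] [Coalgebra k E] (c : C) (d : E) :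
    proj k C E (c ⊗ₜ d) = counit (R := k) d • c := rfl

lemma conv_proj_tmul {C E A : Type*} [AddCommGroup C] [Module k C] [Coalgebra k C]
    [AddCommGroup E] [Module k E] [Coalgebra k E] [Ring A] [Algebra k A]
    (f : C →ₗ[k] A) (g : WithConv (C ⊗[k] E →ₗ[k] A)) (c : C) (d : E) :
    (toConv (f ∘ₗ (proj k C E).toLinearMap) * g).ofConv (c ⊗ₜ d) = ∑ i ∈ (ℛ k c).index,
      f ((ℛ k c).left i) * g.ofConv ((ℛ k c).right i ⊗ₜ d) := by
  rw [conv_tmul]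
  refine Finset.sum_congr rfl fun i _ => ?_
  conv_rhs => rw [← sum_counit_smul (ℛ k d)]
  simp only [TensorProduct.tmul_sum, TensorProduct.tmul_smul, map_sum, map_smul, Finset.mul_sum]
  refine Finset.sum_congr rfl fun j _ => ?_
  simp [proj_tmul]

lemma actLeft_eq (b : R) :
    D.actLeft b = D.act.flip b ∘ₗ (proj k H H).toLinearMap := by
  ext h l
  simp [actLeft, proj_tmul]

lemma twist_eq (b : R) : toConv (D.twist b) =
    toConv ((inl k R H).toLinearMap ∘ₗ D.act.flip b ∘ₗ (proj k H H).toLinearMap) *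
    (toConv ((inl k R H).toLinearMap ∘ₗ D.σ.val.ofConv) *
    toConv ((inr k R H).toLinearMap ∘ₗ LinearMap.mul' k H)) := by
  rw [← mul_assoc, ← actLeft_eq]; rfl

/-- `h ⊗ x ↦ h · f(x)`. -/
def actOn {E : Type*} [AddCommGroup E] [Module k E] (f : E →ₗ[k] R) : H ⊗[k] E →ₗ[k] R :=
  TensorProduct.lift (D.act.compl₂ f)

lemma actOn_tmul {E : Type*} [AddCommGroup E] [Module k E] (f : E →ₗ[k] R) (h : H) (x : E) :
    D.actOn f (h ⊗ₜ x) = D.act h (f x) := rfl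

lemma act_mul_repr (h : H) (a b : R) : D.act h (a * b) =
    ∑ i ∈ (ℛ k h).index, D.act ((ℛ k h).left i) a * D.act ((ℛ k h).right i) b := by
  rw [D.act_mul, ← (ℛ k h).eq]
  simp

lemma actOn_conv {E : Type*} [AddCommGroup E] [Module k E] [Coalgebra k E]
    (f g : E →ₗ[k] R) :
    toConv (D.actOn (toConv f * toConv g).ofConv) = toConv (D.actOn f) * toConv (D.actOn g) := by
  ext h x
  simp only [TensorProduct.AlgebraTensorModule.curry_apply, TensorProduct.curry_apply,
    LinearMap.restrictScalars_self]
  rw [conv_tmul]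
  simp only [actOn_tmul]
  rw [(ℛ k x).convMul_apply, map_sum, Finset.sum_comm]
  simp [act_mul_repr]

lemma twist_mul (b : R) {E : Type*} [AddCommGroup E] [Module k E] [Coalgebra k E]
    (f : E →ₗ[k] R) (g : E →ₗc[k] H) (h : H) (q : E) :
    ∑ j ∈ (ℛ k q).index, D.twist (b * f ((ℛ k q).left j)) (h ⊗ₜ g ((ℛ k q).right j)) =
    (toConv ((inl k R H).toLinearMap ∘ₗ (toConv (D.act.flip b ∘ₗ (proj k H E).toLinearMap) *
        toConv (D.actOn f)).ofConv) *
      toConv ((toConv ((inl k R H).toLinearMap ∘ₗ D.σ.val.ofConv) *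
        toConv ((inr k R H).toLinearMap ∘ₗ LinearMap.mul' k H)).ofConv ∘ₗ
        (Coalgebra.TensorProduct.map (CoalgHom.id k H) g).toLinearMap)).ofConv (h ⊗ₜ q) := by
  rw [conv_tmul, Finset.sum_comm]
  refine Finset.sum_congr rfl fun j _ => ?_
  change (toConv (D.twist _)).ofConv _ = _
  rw [twist_eq, ← LinearMap.comp_assoc, conv_proj_tmul]
  refine Finset.sum_congr rfl fun i _ => ?_
  simp only [LinearMap.comp_apply, conv_proj_tmul]
  congr 2
  simp [act_mul_repr, actOn_tmul]

lemma mulMap_left (a : R) (x y : R ⊗[k] H) :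
    D.mulMap (a ⊗ₜ[k] (1 : H) * x) y = a ⊗ₜ[k] (1 : H) * D.mulMap x y := by
  induction x with
  | zero => simp
  | add x₁ x₂ h₁ h₂ => simp only [mul_add, map_add, LinearMap.add_apply, h₁, h₂]
  | tmul c h =>
    induction y with
    | zero => simp
    | add y₁ y₂ h₁ h₂ => simp only [mul_add, map_add, h₁, h₂]
    | tmul d l => simp [mulMap_tmul, ← mul_assoc]

lemma twist_apply_eq_sum (b : R) {p : H ⊗[k] H} : D.twist b p =
    ∑ i ∈ (ℛ k p).index, (toConv (D.actLeft b) * D.σ.val).ofConv ((ℛ k p).left i) ⊗ₜ[k]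
      LinearMap.mul' k H ((ℛ k p).right i) := by
  change (_ * _ * _ : WithConv (H ⊗[k] H →ₗ[k] R ⊗[k] H)).ofConv p = _
  rw [← comp_conv]
  rw [(ℛ k p).convMul_apply]
  simp [inl, inr]

/-- `h ⊗ (l ⊗ m) ↦ ε(m) h ⊗ l`, as a coalgebra map. -/
def p12 (k H : Type*) [Field k] [Ring H] [HopfAlgebra k H] :
    H ⊗[k] (H ⊗[k] H) →ₗc[k] H ⊗[k] H :=
  (proj k (H ⊗[k] H) H).comp (Coalgebra.TensorProduct.assoc k k H H H).symm.toCoalgHom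

/-- `h ⊗ (l ⊗ m) ↦ h l ⊗ m`, as a coalgebra map. -/
def m12 (k H : Type*) [Field k] [Ring H] [HopfAlgebra k H] :
    H ⊗[k] (H ⊗[k] H) →ₗc[k] H ⊗[k] H :=
  (Coalgebra.TensorProduct.map (Bialgebra.mulCoalgHom k H) (CoalgHom.id k H)).comp
    (Coalgebra.TensorProduct.assoc k k H H H).symm.toCoalgHom

/-- `h ⊗ (l ⊗ m) ↦ h ⊗ l m`, as a coalgebra map. -/
def m23 (k H : Type*) [Field k] [Ring H] [HopfAlgebra k H] :
    H ⊗[k] (H ⊗[k] H) →ₗc[k] H ⊗[k] H :=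
  Coalgebra.TensorProduct.map (CoalgHom.id k H) (Bialgebra.mulCoalgHom k H)

lemma actOn_actLeft_mul (c : R) :
    toConv (D.actOn (D.actLeft c)) * toConv (D.σ.val.ofConv ∘ₗ (p12 k H).toLinearMap) =
      toConv (D.σ.val.ofConv ∘ₗ (p12 k H).toLinearMap) *
        toConv (D.actLeft c ∘ₗ (m12 k H).toLinearMap) := by
  have h1 : toConv (TensorProduct.lift (D.act.compl₂ (D.act.flip c))) * D.σ.val =
      D.σ.val * toConv (D.act.flip c ∘ₗ LinearMap.mul' k H) := by
    rw [D.twisted, mul_assoc, Units.inv_mul, mul_one]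
  have h2 := congrArg (fun f => toConv (f.ofConv ∘ₗ (p12 k H).toLinearMap)) h1
  simp only [conv_comp] at h2
  convert h2 using 2
  · congr 1
    ext h l m
    simp [actOn_tmul, actLeft, p12, proj_tmul]
  · congr 1
    ext h l m
    simp [actLeft, p12, m12, proj_tmul]

lemma cocycle' :
    toConv (D.actOn D.σ.val.ofConv) * toConv (D.σ.val.ofConv ∘ₗ (m23 k H).toLinearMap) =
      toConv (D.σ.val.ofConv ∘ₗ (p12 k H).toLinearMap) *
        toConv (D.σ.val.ofConv ∘ₗ (m12 k H).toLinearMap) := by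
  have a1 : (m23 k H).toLinearMap = LinearMap.lTensor H (LinearMap.mul' k H) := rfl
  have a2 : D.σ.val.ofConv ∘ₗ (p12 k H).toLinearMap =
      TensorProduct.rid k R ∘ₗ TensorProduct.map D.σ.val.ofConv Coalgebra.counit ∘ₗ
        (TensorProduct.assoc k H H H).symm.toLinearMap := by
    ext h l m
    simp [p12, proj_tmul]
  have a3 : (m12 k H).toLinearMap = LinearMap.rTensor H (LinearMap.mul' k H) ∘ₗ
      (TensorProduct.assoc k H H H).symm.toLinearMap := rfl
  rw [a1, a2, a3]
  exact D.cocycle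

lemma mulMap_assoc_left (a b c : R) (h l m : H) :
    D.mulMap (D.mulMap (a ⊗ₜ h) (b ⊗ₜ l)) (c ⊗ₜ m) = a ⊗ₜ[k] (1 : H) *
      (toConv ((inl k R H).toLinearMap ∘ₗ (toConv (D.actLeft b) * D.σ.val).ofConv ∘ₗ
          (p12 k H).toLinearMap) *
        toConv (D.twist c ∘ₗ (m12 k H).toLinearMap)).ofConv (h ⊗ₜ (l ⊗ₜ m)) := by
  rw [mulMap_tmul, mulMap_left, twist_apply_eq_sum]
  congr 1
  have := congrArg (fun f => f.ofConv (h ⊗ₜ[k] (l ⊗ₜ[k] m)))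
    (conv_comp (Coalgebra.TensorProduct.assoc k k H H H).symm.toCoalgHom
      (toConv (((inl k R H).toLinearMap ∘ₗ (toConv (D.actLeft b) * D.σ.val).ofConv) ∘ₗ
          (proj k (H ⊗[k] H) H).toLinearMap))
      (toConv (D.twist c ∘ₗ (Coalgebra.TensorProduct.map (Bialgebra.mulCoalgHom k H)
        (CoalgHom.id k H)).toLinearMap)))
  refine Eq.trans ?_ this
  simp only [map_sum, LinearMap.sum_apply, mulMap_tmul]
  exact (conv_proj_tmul ((inl k R H).toLinearMap ∘ₗ (toConv (D.actLeft b) * D.σ.val).ofConv)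
    (toConv (D.twist c ∘ₗ (Coalgebra.TensorProduct.map (Bialgebra.mulCoalgHom k H)
        (CoalgHom.id k H)).toLinearMap)) (h ⊗ₜ[k] l) m).symm

lemma mulMap_assoc_right (a b c : R) (h l m : H) :
    D.mulMap (a ⊗ₜ h) (D.mulMap (b ⊗ₜ l) (c ⊗ₜ m)) = a ⊗ₜ[k] (1 : H) *
      (toConv ((inl k R H).toLinearMap ∘ₗ
          (toConv (D.act.flip b ∘ₗ (proj k H (H ⊗[k] H)).toLinearMap) *
            toConv (D.actOn (toConv (D.actLeft c) * D.σ.val).ofConv)).ofConv) *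
        toConv ((toConv ((inl k R H).toLinearMap ∘ₗ D.σ.val.ofConv) *
          toConv ((inr k R H).toLinearMap ∘ₗ LinearMap.mul' k H)).ofConv ∘ₗ
          (m23 k H).toLinearMap)).ofConv (h ⊗ₜ (l ⊗ₜ m)) := by
  rw [D.mulMap_tmul b c, twist_apply_eq_sum, Finset.mul_sum, map_sum]
  simp only [Algebra.TensorProduct.tmul_mul_tmul, one_mul, mulMap_tmul]
  rw [← Finset.mul_sum]
  congr 1
  exact D.twist_mul b (toConv (D.actLeft c) * D.σ.val).ofConv (Bialgebra.mulCoalgHom k H) h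
    (l ⊗ₜ m)

lemma mulMap_assoc (x y z : R ⊗[k] H) :
    D.mulMap (D.mulMap x y) z = D.mulMap x (D.mulMap y z) := by
  induction x with
  | zero => simp
  | add x₁ x₂ h₁ h₂ => simp only [map_add, LinearMap.add_apply, h₁, h₂]
  | tmul a h =>
    induction y with
    | zero => simp
    | add y₁ y₂ h₁ h₂ => simp only [map_add, LinearMap.add_apply, h₁, h₂]
    | tmul b l =>
      induction z with
      | zero => simp
      | add z₁ z₂ h₁ h₂ => simp only [map_add, h₁, h₂]
      | tmul c m =>
        rw [mulMap_assoc_left, mulMap_assoc_right]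
        congr 3
        have e1 : toConv ((toConv (D.actLeft b) * D.σ.val).ofConv ∘ₗ (p12 k H).toLinearMap) =
            toConv (D.act.flip b ∘ₗ (proj k H (H ⊗[k] H)).toLinearMap) *
              toConv (D.σ.val.ofConv ∘ₗ (p12 k H).toLinearMap) := by
          rw [conv_comp]
          congr 2
          ext h l m
          simp [actLeft, p12, proj_tmul, smul_smul, mul_comm]
        have e2 := comp_conv (inl k R H)
          (toConv (D.act.flip b ∘ₗ (proj k H (H ⊗[k] H)).toLinearMap))
          (toConv (D.σ.val.ofConv ∘ₗ (p12 k H).toLinearMap))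
        have e3 : toConv (D.twist c ∘ₗ (m12 k H).toLinearMap) =
            toConv ((inl k R H).toLinearMap ∘ₗ (D.actLeft c ∘ₗ (m12 k H).toLinearMap)) *
            toConv ((inl k R H).toLinearMap ∘ₗ (D.σ.val.ofConv ∘ₗ (m12 k H).toLinearMap)) *
            toConv ((inr k R H).toLinearMap ∘ₗ (LinearMap.mul' k H ∘ₗ (m12 k H).toLinearMap)) := by
          have := conv_comp (m12 k H) (toConv ((inl k R H).toLinearMap ∘ₗ D.actLeft c) *
            toConv ((inl k R H).toLinearMap ∘ₗ D.σ.val.ofConv))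
            (toConv ((inr k R H).toLinearMap ∘ₗ LinearMap.mul' k H))
          refine this.trans ?_
          rw [conv_comp]
          rfl
        have e4 : LinearMap.mul' k H ∘ₗ (m12 k H).toLinearMap =
            LinearMap.mul' k H ∘ₗ (m23 k H).toLinearMap := by
          ext h l m
          simp [m12, m23, mul_assoc]
        have e5 := D.actOn_conv (D.actLeft c) D.σ.val.ofConv
        have e6 := congrArg (fun f => toConv ((inl k R H).toLinearMap ∘ₗ f.ofConv))
          (D.actOn_actLeft_mul c)
        have e7 := congrArg (fun f => toConv ((inl k R H).toLinearMap ∘ₗ f.ofConv)) D.cocycle'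
        simp only [comp_conv] at e6 e7
        rw [e3, e4, conv_comp]
        have e8 := congrArg (fun f => toConv ((inl k R H).toLinearMap ∘ₗ f.ofConv)) e1
        simp only [comp_conv] at e8
        erw [e8, e5]
        simp only [comp_conv]
        simp only [mul_assoc] at e6 e7 ⊢
        congr 1
        rw [← mul_assoc (toConv ((inl k R H).toLinearMap ∘ₗ D.σ.val.ofConv ∘ₗ _)), ← e6]
        simp only [mul_assoc]
        congr 1
        rw [← mul_assoc, ← e7]
        simp only [mul_assoc]
        rfl

lemma conv_one_tmul {A : Type*} [Ring A] [Algebra k A]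
    (f g : WithConv (H ⊗[k] H →ₗ[k] A)) (l : H) :
    (f * g).ofConv (1 ⊗ₜ l) = ∑ j ∈ (ℛ k l).index,
      f.ofConv (1 ⊗ₜ (ℛ k l).left j) * g.ofConv (1 ⊗ₜ (ℛ k l).right j) := by
  rw [LinearMap.convMul_def]
  simp only [LinearMap.comp_apply, TensorProduct.comul_tmul]
  rw [Bialgebra.comul_one, Algebra.TensorProduct.one_def, ← (ℛ k l).eq]
  simp [TensorProduct.tmul_sum]

lemma conv_tmul_one {A : Type*} [Ring A] [Algebra k A]
    (f g : WithConv (H ⊗[k] H →ₗ[k] A)) (h : H) :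
    (f * g).ofConv (h ⊗ₜ 1) = ∑ j ∈ (ℛ k h).index,
      f.ofConv ((ℛ k h).left j ⊗ₜ 1) * g.ofConv ((ℛ k h).right j ⊗ₜ 1) := by
  rw [LinearMap.convMul_def]
  simp only [LinearMap.comp_apply, TensorProduct.comul_tmul]
  rw [Bialgebra.comul_one, Algebra.TensorProduct.one_def, ← (ℛ k h).eq]
  simp [TensorProduct.sum_tmul]

lemma twist_one_tmul (b : R) (l : H) : D.twist b (1 ⊗ₜ l) = b ⊗ₜ l := by
  change (toConv (D.twist b)).ofConv _ = _
  have (l : H) : (toConv ((inl k R H).toLinearMap ∘ₗ D.σ.val.ofConv) *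
      toConv ((inr k R H).toLinearMap ∘ₗ LinearMap.mul' k H)).ofConv (1 ⊗ₜ l) = 1 ⊗ₜ l := by
    rw [conv_one_tmul]
    conv_rhs => rw [← sum_counit_smul (ℛ k l)]
    simp [σ_one_left, TensorProduct.tmul_sum, Algebra.algebraMap_eq_smul_one,
      TensorProduct.smul_tmul', inr]
  rw [twist_eq, conv_one_tmul]
  simp only [this]
  conv_rhs => rw [← sum_counit_smul (ℛ k l)]
  simp [TensorProduct.tmul_sum, inl, proj_tmul, one_act, TensorProduct.smul_tmul']

lemma twist_one (h : H) : D.twist 1 (h ⊗ₜ 1) = 1 ⊗ₜ h := by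
  change (toConv (D.twist 1)).ofConv _ = _
  have (h : H) : (toConv ((inl k R H).toLinearMap ∘ₗ D.σ.val.ofConv) *
      toConv ((inr k R H).toLinearMap ∘ₗ LinearMap.mul' k H)).ofConv (h ⊗ₜ 1) = 1 ⊗ₜ h := by
    rw [conv_tmul_one]
    conv_rhs => rw [← sum_counit_smul (ℛ k h)]
    simp [σ_one_right, TensorProduct.tmul_sum, Algebra.algebraMap_eq_smul_one,
      TensorProduct.smul_tmul', inr]
  rw [twist_eq, conv_tmul_one]
  simp only [this]
  conv_rhs => rw [← sum_counit_smul (ℛ k h)]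
  simp [TensorProduct.tmul_sum, proj_tmul, act_one, Algebra.algebraMap_eq_smul_one,
    TensorProduct.smul_tmul']

lemma one_mulMap (x : R ⊗[k] H) : D.mulMap (1 ⊗ₜ 1) x = x := by
  induction x with
  | zero => simp
  | add x₁ x₂ h₁ h₂ => simp only [map_add, h₁, h₂]
  | tmul a h => rw [mulMap_tmul, twist_one_tmul]; simp

lemma mulMap_one (x : R ⊗[k] H) : D.mulMap x (1 ⊗ₜ 1) = x := by
  induction x with
  | zero => simp
  | add x₁ x₂ h₁ h₂ => simp only [map_add, LinearMap.add_apply, h₁, h₂]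
  | tmul a h => rw [mulMap_tmul, twist_one]; simp

end Assoc

/-- The crossed product `R #_σ H`: the vector space `R ⊗ H` with the multiplication
`(a # h) (b # l) = ∑ a (h₁ · b) σ(h₂, l₁) # h₃ l₂`. -/
@[nolint unusedArguments]
def Product (_D : CrossedSystem k H R) : Type _ := R ⊗[k] H

namespace Product

instance : AddCommGroup D.Product := inferInstanceAs (AddCommGroup (R ⊗[k] H))

instance : Module k D.Product := inferInstanceAs (Module k (R ⊗[k] H))

instance : Ring D.Product where
  __ := (inferInstance : AddCommGroup D.Product)
  mul x y := D.mulMap x y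
  one := (1 : R) ⊗ₜ[k] (1 : H)
  left_distrib x y z := map_add (D.mulMap x) y z
  right_distrib x y z := LinearMap.map_add₂ D.mulMap x y z
  zero_mul x := LinearMap.map_zero₂ D.mulMap x
  mul_zero x := map_zero (D.mulMap x)
  mul_assoc := D.mulMap_assoc
  one_mul := D.one_mulMap
  mul_one := D.mulMap_one

instance : Algebra k D.Product :=
  Algebra.ofModule (fun r x y => LinearMap.map_smul₂ D.mulMap r x y)
    (fun r x y => map_smul (D.mulMap x) r y)

end Product

/-- The embedding `R → R #_σ H`, `r ↦ r # 1`. -/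
def ofBase : R →+* D.Product where
  toFun r := r ⊗ₜ[k] (1 : H)
  map_one' := rfl
  map_mul' r s := by
    change _ = D.mulMap (r ⊗ₜ[k] (1 : H)) (s ⊗ₜ[k] (1 : H))
    rw [mulMap_tmul, twist_one_tmul]
    simp
  map_zero' := TensorProduct.zero_tmul _ _
  map_add' r s := TensorProduct.add_tmul _ _ _

/-- `I #_σ H`: the span in `R #_σ H` of the elements `a # h` with `a ∈ I`, that is, the image of
`I ⊗ H` in `R ⊗ H`. -/
def smash (I : Ideal R) : Submodule k D.Product :=
  LinearMap.range (LinearMap.rTensor H (I.restrictScalars k).subtype : _ →ₗ[k] R ⊗[k] H)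

/-- `(I : H)`, the set of all `r` with `h · r ∈ I` for every `h ∈ H`. -/
def stableCore (I : Ideal R) : Ideal R where
  carrier := {r | ∀ h, D.act h r ∈ I}
  add_mem' ha hb h := by
    rw [map_add]
    exact I.add_mem (ha h) (hb h)
  zero_mem' h := by
    rw [map_zero]
    exact I.zero_mem
  smul_mem' c x hx h := by
    rw [smul_eq_mul, act_mul_repr]
    exact I.sum_mem fun i _ => I.mul_mem_left _ (hx _)

/-- `r_{Hj}(R) = r_j(R #_σ H) ∩ R`. -/
def jacobsonH : Ideal R := (Ring.jacobson D.Product).comap D.ofBase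

/-- `r_{jH}(R) = (r_j(R) : H)`. -/
def jacobsonCore : Ideal R := D.stableCore (Ring.jacobson R)

end CrossedSystem

/-- `r_j(A ⊗ F) = r_j(A) ⊗ F`, where the right-hand side is the image of `r_j(A) ⊗ F` in
`A ⊗ F`. -/
def JacobsonCommutesWithBaseChange (k A F : Type*) [Field k] [Ring A] [Algebra k A] [Field F]
    [Algebra k F] : Prop :=
  (Ring.jacobson (A ⊗[k] F)).restrictScalars k =
    LinearMap.range (LinearMap.rTensor F ((Ring.jacobson A).restrictScalars k).subtype)

end

/-! Write J for the Jacobson radical, `S = F ⊗ R` and `B = F ⊗ (R #_σ H)`; a `k`-basis of `H` gives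
an `S`-basis of `B`. By `JacobsonCommutesWithBaseChange.mem_iff`, membership in J(R) and J(R #_σ H)
can be tested over `F`. Two facts then suffice: elements of J(B) have coordinates in J(S), and J(S)
lies in J(B). `jacobson_eq_smash` deduces every assertion from them.

Over `F` the Hopf algebra turns into a finite group algebra or the dual of one. Semisimplicity gives
a left integral of counit one, hence a separability idempotent, so `H` is finite-dimensional and, if
commutative, stays reduced over `F`. Cosemisimplicity gives a normalized integral on `H`, which
plays the same role for the dual algebra. So group-likes span `F ⊗ H` in the cocommutative case
(`span_groupLike`), and characters span the `F`-valued forms on `H` in the commutative case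
(`span_characters`). The integrals also force the order of the group G to be nonzero in `F`.

Cocommutative case: `B` is a crossed product of `S` with G. Nakayama's lemma gives J(S) ⊆ J(B)
(`smul_one_mem_jacobson`). By Maschke's theorem the radical of `B` lies in its radical as an
`S`-module (`jacobson_le_jacobson`), which the `S`-linear coordinates send into J(S).

Commutative case: G acts on `B` fixing `S`, and `B` is a Galois extension of `S`: traces lie in `S`,
and there are p_i, q_i with ∑ p_i χ(q_i) equal to 1 for χ = 1 and to 0 otherwise
(`exists_galois_elements`). Consequently the opposite of End_S(B) is a crossed product of `B` with
G, and the two inclusions hold for that pair of rings. As `B` is free of finite rank over `S`, the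
radical of End_S(B) is governed by J(S), and this carries the inclusions down to `S` and `B`
(`jacobson_of_galois`). -/

/-! ### Crossed products with a finite group: Maschke and Nakayama -/

section CrossedGroup

/-- Units `u g` of `B`, indexed by a group, that make `B` a crossed product of `S` with the group,
except that they need not be linearly independent over `S`. -/
structure IsCrossedGroupFamily (S : Type*) {B G : Type*} [Ring S] [Ring B] [Module S B] [Group G]
    (u : G → Bˣ) : Prop where
  conj : ∀ g, ∃ α : S ≃+* S, ∀ s : S, (u g : B) * (s • (1 : B)) = α s • (u g : B)
  mul : ∀ g h, ∃ s : Sˣ, (u g : B) * u h = (s : S) • (u (g * h) : B)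
  span : Submodule.span S (Set.range fun g => (u g : B)) = ⊤

namespace IsCrossedGroupFamily

variable {S B G : Type*} [Ring S] [Ring B] [Module S B] [Group G]
  {u : G → Bˣ} (hu : IsCrossedGroupFamily S u)
  {M : Type*} [AddCommGroup M] [Module S M] [Module B M] [IsScalarTower S B M]

include hu

/-- The automorphism of `S` given by conjugation with `u g`. -/
noncomputable def aut (g : G) : S ≃+* S := (hu.conj g).choose

lemma mul_smul_one (g : G) (s : S) : (u g : B) * (s • (1 : B)) = hu.aut g s • (u g : B) :=
  (hu.conj g).choose_spec s

lemma smul_smul_eq (g : G) (s : S) (m : M) :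
    (u g : B) • s • m = hu.aut g s • (u g : B) • m := by
  rw [← smul_one_smul B s m, ← mul_smul, hu.mul_smul_one, smul_assoc]

lemma inv_smul_smul_eq (g : G) (s : S) (m : M) :
    ((u g)⁻¹ : Bˣ) • s • m = (hu.aut g).symm s • ((u g)⁻¹ : Bˣ) • m := by
  rw [inv_smul_eq_iff, Units.smul_def, hu.smul_smul_eq, RingEquiv.apply_symm_apply,
    ← Units.smul_def, smul_inv_smul]

/-- The scalar is the cocycle value pulled to the right of `u (h * g)` by the inverse automorphism,
so that `u (h * g)` times `t` acts as `u h * u g`. A single `t` has to serve for all `m`, since it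
is later moved through `S`-linear maps. -/
lemma exists_inv_smul (g h : G) : ∃ t : S, ∀ m : M,
    ((u (h * g))⁻¹ : Bˣ) • (u h : B) • m = t • ((u g)⁻¹ : Bˣ) • m ∧
    (u (h * g) : B) • t • m = (u h : B) • (u g : B) • m := by
  obtain ⟨s, hs⟩ := hu.mul h g
  have key (m : M) : (u (h * g) : B) • (hu.aut (h * g)).symm s • m
      = (u h : B) • (u g : B) • m := by
    rw [hu.smul_smul_eq, RingEquiv.apply_symm_apply, ← smul_assoc, ← hs, mul_smul]
  refine ⟨(hu.aut (h * g)).symm s, fun m => ⟨?_, key m⟩⟩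
  rw [inv_smul_eq_iff, Units.smul_def, key, ← Units.smul_def (u g), smul_inv_smul]

/-- An induction principle for subsets of `B` that are closed under addition and contain all
products of scalars from `S` with the units `u g`. -/
lemma induction {p : B → Prop} (h0 : p 0) (hadd : ∀ a b, p a → p b → p (a + b))
    (hsmul : ∀ (s : S) b, p b → p (s • b)) (hp : ∀ g, p (u g)) (b : B) : p b := by
  have hb : b ∈ Submodule.span S (Set.range fun g => (u g : B)) := by
    rw [hu.span]; trivial
  induction hb using Submodule.span_induction with
  | mem x hx => obtain ⟨g, rfl⟩ := hx; exact hp g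
  | zero => exact h0
  | add x y _ _ hx hy => exact hadd x y hx hy
  | smul s x _ hx => exact hsmul s x hx

/-- The intersection of the translates of an `S`-submodule, which is a `B`-submodule. -/
def core (N : Submodule S M) : Submodule B M where
  carrier := {m | ∀ g, ((u g)⁻¹ : Bˣ) • m ∈ N}
  add_mem' ha hb g := by rw [smul_add]; exact N.add_mem (ha g) (hb g)
  zero_mem' g := by rw [smul_zero]; exact N.zero_mem
  smul_mem' b m hm := by
    refine hu.induction (p := fun b => b • m ∈ {m | ∀ g, ((u g)⁻¹ : Bˣ) • m ∈ N})
      ?_ ?_ ?_ ?_ b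
    · intro g
      rw [zero_smul, smul_zero]
      exact N.zero_mem
    · intro a b ha hb g
      rw [add_smul, smul_add]
      exact N.add_mem (ha g) (hb g)
    · intro s b hb g
      rw [smul_assoc, hu.inv_smul_smul_eq]
      exact N.smul_mem _ (hb g)
    · intro h g
      obtain ⟨t, ht⟩ := hu.exists_inv_smul (M := M) (h⁻¹ * g) h
      have := (ht m).1
      rw [mul_inv_cancel_left] at this
      rw [this]
      exact N.smul_mem _ (hm _)

/-- The unit `u 1` need not be `1`, but cancelling in `u 1 * u 1 = s • u 1` shows that it is a
scalar, which `N` absorbs. -/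
lemma core_le [IsScalarTower S B B] (N : Submodule S M) (m : M) (hm : m ∈ hu.core N) : m ∈ N := by
  have h := hm 1
  obtain ⟨s, hs⟩ := hu.mul 1 1
  rw [mul_one] at hs
  have h1 : (u 1 : B) = (s : S) • (1 : B) := by
    have := congrArg (· * ((u 1)⁻¹ : Bˣ).val) hs
    simpa [mul_assoc, smul_mul_assoc] using this
  have h2 : m = (s : S) • ((u 1)⁻¹ : Bˣ) • m := by
    rw [← smul_one_smul B (s : S) _, ← h1, ← Units.smul_def (u 1), smul_inv_smul]
  rw [h2]
  exact N.smul_mem _ h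

/-- Multiplication by the inverse of `u g`, as a semilinear map. -/
noncomputable def invSmul (g : G) : M →ₛₗ[((hu.aut g).symm : S →+* S)] M where
  toFun m := ((u g)⁻¹ : Bˣ) • m
  map_add' := smul_add _
  map_smul' s m := hu.inv_smul_smul_eq g s m


lemma invSmul_surjective (g : G) :
    Function.Surjective (hu.invSmul g : M →ₛₗ[((hu.aut g).symm : S →+* S)] M) :=
  fun m => ⟨u g • m, inv_smul_smul _ _⟩

omit hu in
lemma inv_natCast_smul_comm {n : ℕ} {v : Bˣ} (hv : (v : B) = n) (b : B) (m : M) :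
    b • v⁻¹ • m = v⁻¹ • b • m := by
  have h : Commute b v := hv ▸ Nat.commute_cast b n
  simp only [Units.smul_def, ← mul_smul, h.units_inv_right.eq]

/-- Maschke's theorem: a `B`-module that is semisimple over `S` is semisimple over `B`. -/
lemma isSemisimpleModule_of_restrict [Fintype G] (hG : IsUnit (Fintype.card G : B))
    [IsSemisimpleModule S M] : IsSemisimpleModule B M := by
  refine (isSemisimpleModule_iff B M).2 ⟨fun P => ?_⟩
  obtain ⟨π, hπ⟩ := IsSemisimpleModule.extension_property
    (P.restrictScalars S).subtype (P.restrictScalars S).injective_subtype LinearMap.id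
  have hπ (x : M) (hx : x ∈ P) : (π x : M) = x :=
    congrArg Subtype.val (LinearMap.congr_fun hπ ⟨x, hx⟩)
  have hπP (x : M) : (π x : M) ∈ P := (π x).2
  obtain ⟨v, hv⟩ := hG
  -- The `S`-linear retraction is averaged over its conjugates. A conjugate does not change when `u
  -- g` is rescaled by a unit of `S`, so the cocycle does no harm.
  let T (m : M) : M := v⁻¹ • ∑ g, (u g : B) • (π (((u g)⁻¹ : Bˣ) • m) : M)
  have T_add (a b : M) : T (a + b) = T a + T b := by
    simp only [T, smul_add, map_add, Submodule.coe_add, Finset.sum_add_distrib]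
  have T_mem (m : M) : T m ∈ P :=
    P.smul_mem _ (P.sum_mem fun g _ => P.smul_mem _ (hπP _))
  have T_smul (b : B) (m : M) : T (b • m) = b • T m := by
    revert m
    refine hu.induction (p := fun b => ∀ m, T (b • m) = b • T m) ?_ ?_ ?_ ?_ b
    · intro m
      simp [T]
    · intro a b ha hb m
      rw [add_smul, T_add, ha, hb, add_smul]
    · intro s b hb m
      rw [smul_assoc, smul_assoc, ← hb, ← smul_one_smul B s (T _)]
      simp only [T]
      rw [inv_natCast_smul_comm (M := M) hv]
      congr 1
      rw [Finset.smul_sum]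
      refine Finset.sum_congr rfl fun g _ => ?_
      rw [hu.inv_smul_smul_eq, map_smul, Submodule.coe_smul, hu.smul_smul_eq,
        RingEquiv.apply_symm_apply, smul_one_smul]
    · intro h m
      simp only [T]
      rw [inv_natCast_smul_comm (M := M) hv]
      congr 1
      rw [Finset.smul_sum]
      refine (Fintype.sum_equiv (Equiv.mulLeft h) _ _ fun g => ?_).symm
      obtain ⟨t, ht⟩ := hu.exists_inv_smul (M := M) g h
      rw [Equiv.coe_mulLeft, (ht m).1, π.map_smul t, Submodule.coe_smul, (ht _).2]
  have T_proj (m : M) (hm : m ∈ P) : T m = m := by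
    have (g : G) : (u g : B) • (π (((u g)⁻¹ : Bˣ) • m) : M) = m := by
      have h : ((u g)⁻¹ : Bˣ) • m ∈ P := P.smul_mem _ hm
      rw [hπ _ h, ← Units.smul_def (u g), smul_inv_smul]
    simp only [T, this, Finset.sum_const, Finset.card_univ]
    rw [inv_smul_eq_iff, Units.smul_def, hv, Nat.cast_smul_eq_nsmul]
  let p : M →ₗ[B] P :=
    { toFun := fun m => ⟨T m, T_mem m⟩
      map_add' := fun a b => Subtype.ext (T_add a b)
      map_smul' := fun a b => Subtype.ext (T_smul a b) }
  exact ⟨LinearMap.ker p, LinearMap.isCompl_of_proj fun x => Subtype.ext (T_proj x x.2)⟩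

/-- The radical of a `B`-module is contained in its radical as an `S`-module. -/
theorem jacobson_le_jacobson [IsScalarTower S B B] [Fintype G]
    (hG : IsUnit (Fintype.card G : B)) (m : M) (hm : m ∈ Module.jacobson B M) :
    m ∈ Module.jacobson S M := by
  rw [Module.jacobson, Submodule.mem_sInf]
  intro N hN
  refine hu.core_le N m ?_
  -- Modulo its core, `M` embeds into a finite product of simple modules, the quotients by the
  -- translates of `N`. It is thus semisimple over `S`, by Maschke over `B`, and its radical over
  -- `B` vanishes.
  have hss : IsSemisimpleModule S (M ⧸ hu.core N) := by
    let Ng (g : G) : Submodule S M :=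
      N.comap (hu.invSmul g : M →ₛₗ[((hu.aut g).symm : S →+* S)] M)
    have (g : G) : IsSimpleModule S (M ⧸ Ng g) :=
      isSimpleModule_iff_isCoatom.2
        ((Submodule.isCoatom_comap_iff (hu.invSmul_surjective g)).2 hN)
    let f : M →ₗ[S] Π g, M ⧸ Ng g := LinearMap.pi fun g => (Ng g).mkQ
    have hf : LinearMap.ker f = (hu.core N).restrictScalars S := by
      ext x
      simp only [f, LinearMap.ker_pi, Submodule.ker_mkQ, Submodule.mem_iInf]
      exact Iff.rfl
    have h1 : IsSemisimpleModule S (M ⧸ LinearMap.ker f) :=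
      .of_injective ((LinearMap.ker f).liftQ f le_rfl)
        (LinearMap.ker_eq_bot.1 (Submodule.ker_liftQ_eq_bot _ _ _ le_rfl))
    rw [hf] at h1
    exact h1.congr (Submodule.Quotient.restrictScalarsEquiv S (hu.core N)).symm
  have := hu.isSemisimpleModule_of_restrict (M := M ⧸ hu.core N) hG
  exact Module.jacobson_le_of_eq_bot (IsSemisimpleModule.jacobson_eq_bot B _) hm

/-- The radical of `S` is contained in the radical of `B`. -/
theorem smul_one_mem_jacobson [IsScalarTower S B B] [Finite G] {s : S}
    (hs : s ∈ Ring.jacobson S) : s • (1 : B) ∈ Ring.jacobson B := by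
  have hfin : Module.Finite S B := ⟨Submodule.fg_def.2 ⟨_, Set.finite_range _, hu.span⟩⟩
  -- Conjugation by `u g` is an automorphism of `S`, so it preserves the radical.
  have hK (y : B) : y * (s • (1 : B)) ∈ Ring.jacobson S • (⊤ : Submodule S B) := by
    refine hu.induction
      (p := fun y => y * (s • (1 : B)) ∈ Ring.jacobson S • (⊤ : Submodule S B)) ?_ ?_ ?_ ?_ y
    · rw [zero_mul]
      exact Submodule.zero_mem _
    · intro a b ha hb
      rw [add_mul]
      exact Submodule.add_mem _ ha hb
    · intro t b hb
      rw [smul_mul_assoc]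
      exact Submodule.smul_mem _ _ hb
    · intro g
      rw [hu.mul_smul_one]
      refine Submodule.smul_mem_smul ?_ trivial
      exact Ring.le_comap_jacobson (hu.aut g : S →+* S) hs
  rw [← Ideal.jacobson_bot, Ideal.mem_jacobson_iff]
  intro y
  let φ : B →ₗ[S] B :=
    { toFun := fun b => b * (1 + y * (s • (1 : B)))
      map_add' := fun a b => add_mul _ _ _
      map_smul' := fun a b => smul_mul_assoc _ _ _ }
  -- Nakayama: a maximal submodule containing the range also contains the radical multiples, hence
  -- `b = b * (1 + y * s) - b * y * s` for every `b`. Surjectivity then supplies the left inverse of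
  -- `1 + y * s`.
  have hφ : LinearMap.range φ = ⊤ := by
    by_contra hne
    obtain ⟨m, hm, hle⟩ := (eq_top_or_exists_le_coatom (LinearMap.range φ)).resolve_left hne
    have hJ : Ring.jacobson S • (⊤ : Submodule S B) ≤ m :=
      (Ring.jacobson_smul_top_le S B).trans (sInf_le hm)
    refine hm.1 (eq_top_iff.2 fun b _ => ?_)
    have h1 : b * (1 + y * (s • (1 : B))) ∈ m := hle ⟨b, rfl⟩
    have h2 : b * y * (s • (1 : B)) ∈ m := hJ (hK _)
    have := m.sub_mem h1 h2
    rwa [mul_add, mul_one, ← mul_assoc, add_sub_cancel_right] at this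
  obtain ⟨z, hz⟩ := LinearMap.range_eq_top.1 hφ 1
  refine ⟨z, ?_⟩
  change z * (1 + y * (s • (1 : B))) = 1 at hz
  rw [Ideal.mem_bot, mul_assoc, sub_eq_zero]
  rwa [mul_add, mul_one, add_comm] at hz

end IsCrossedGroupFamily
end CrossedGroup

/-! ### Endomorphism rings and Galois extensions -/

section EndJacobson

open MulOpposite

variable {S B : Type*} [Ring S]

section Module

variable [AddCommGroup B] [Module S B]

/-- The coordinates of the values of an element of the radical of `End B`, for a free module `B`,
lie in the radical of the base ring. -/
lemma repr_apply_mem_jacobson {ι : Type*} (e : Module.Basis ι S B) {f : Module.End S B}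
    (hf : op f ∈ Ring.jacobson (Module.End S B)ᵐᵒᵖ) (x : B) (i : ι) :
    e.repr (f x) i ∈ Ring.jacobson S := by
  rw [← Ideal.jacobson_bot, Ideal.mem_jacobson_iff]
  intro s
  let π : B →ₗ[S] S := e.coord i
  -- With `l` below, `l * f * g` sends `b` to `(π b * s * π (f x)) • e i`. Evaluating the
  -- quasi-inverse relation at `e i` and taking the coordinate turns it into one in `S`.
  let g : Module.End S B := (LinearMap.toSpanSingleton S B (s • x)) ∘ₗ π
  let l : Module.End S B := (LinearMap.toSpanSingleton S B (e i)) ∘ₗ π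
  have hl : op (l * f * g) ∈ Ring.jacobson (Module.End S B)ᵐᵒᵖ := by
    rw [op_mul, op_mul]
    exact Ideal.mul_mem_left _ _ (Ideal.mul_mem_right _ _ hf)
  rw [← Ideal.jacobson_bot, Ideal.mem_jacobson_iff] at hl
  obtain ⟨z, hz⟩ := hl 1
  rw [mul_one, Ideal.mem_bot, sub_eq_zero] at hz
  have h1 := congrArg (fun t : (Module.End S B)ᵐᵒᵖ => π (unop t (e i))) hz
  refine ⟨π (unop z (e i)), ?_⟩
  rw [Ideal.mem_bot, sub_eq_zero]
  simpa [π, g, l, mul_assoc] using h1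

/-- An endomorphism of a finite projective module with values in the radical lies in the radical
of the endomorphism ring. -/
lemma op_mem_jacobson_of_forall_mem [Module.Finite S B] [Module.Projective S B]
    {f : Module.End S B} (hf : ∀ x, f x ∈ Ring.jacobson S • (⊤ : Submodule S B)) :
    op f ∈ Ring.jacobson (Module.End S B)ᵐᵒᵖ := by
  rw [← Ideal.jacobson_bot, Ideal.mem_jacobson_iff]
  intro y
  let φ : B →ₗ[S] B := 1 + f * unop y
  have hφ : LinearMap.range φ = ⊤ := by
    by_contra hne
    obtain ⟨m, hm, hle⟩ := (eq_top_or_exists_le_coatom (LinearMap.range φ)).resolve_left hne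
    have hJ : Ring.jacobson S • (⊤ : Submodule S B) ≤ m :=
      (Ring.jacobson_smul_top_le S B).trans (sInf_le hm)
    refine hm.1 (eq_top_iff.2 fun b _ => ?_)
    have := m.sub_mem (hle ⟨b, rfl⟩) (hJ (hf (unop y b)))
    simpa [φ] using this
  -- Projectivity splits the surjection `φ`; the section is a right inverse, which is a left inverse
  -- in the opposite ring.
  obtain ⟨z, hz⟩ := Module.projective_lifting_property φ LinearMap.id (LinearMap.range_eq_top.1 hφ)
  refine ⟨op z, ?_⟩
  rw [Ideal.mem_bot, sub_eq_zero]
  apply unop_injective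
  rw [unop_add, unop_mul, unop_mul, unop_op, unop_op, unop_one, ← Module.End.one_eq_id] at *
  rw [← hz]
  change f * (unop y * z) + z = (1 + f * unop y) * z
  rw [add_mul, one_mul, mul_assoc, add_comm]

end Module

variable [Ring B] [Module S B] [IsScalarTower S B B]

variable (S B) in
/-- Right multiplications, as a ring homomorphism to the opposite of the endomorphism ring. -/
def mulRightHom : B →+* (Module.End S B)ᵐᵒᵖ where
  toFun b := op
    { toFun := fun x => x * b
      map_add' := fun x y => add_mul x y b
      map_smul' := fun s x => smul_mul_assoc s x b }
  map_one' := unop_injective (LinearMap.ext mul_one)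
  map_mul' b c := unop_injective (LinearMap.ext fun x => (mul_assoc x b c).symm)
  map_zero' := unop_injective (LinearMap.ext mul_zero)
  map_add' b c := unop_injective (LinearMap.ext fun x => mul_add x b c)

lemma unop_mulRightHom_apply (b x : B) : unop (mulRightHom S B b) x = x * b := rfl

/-- The opposite of the endomorphism ring as a module over `B` via right multiplications. -/
abbrev endOpModule : Module B (Module.End S B)ᵐᵒᵖ := Module.compHom _ (mulRightHom S B)

attribute [local instance] endOpModule

lemma endOp_smul_def (b : B) (f : (Module.End S B)ᵐᵒᵖ) : b • f = mulRightHom S B b * f := rfl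

lemma unop_endOp_smul_apply (b : B) (f : (Module.End S B)ᵐᵒᵖ) (x : B) :
    unop (b • f) x = unop f (x * b) := rfl

lemma endOp_isScalarTower : IsScalarTower B (Module.End S B)ᵐᵒᵖ (Module.End S B)ᵐᵒᵖ :=
  ⟨fun b f g => mul_assoc (mulRightHom S B b) f g⟩

attribute [local instance] endOp_isScalarTower

variable {G : Type*} [Group G] (a : G →* (B →+* B)) (ha : ∀ g (s : S), a g (s • 1) = s • 1)

lemma map_mul_inv_apply (g : G) (x : B) : a g (a g⁻¹ x) = x := by
  rw [← RingHom.comp_apply, ← RingHom.mul_def, ← map_mul, mul_inv_cancel, map_one]; rfl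

lemma map_inv_mul_apply (g : G) (x : B) : a g⁻¹ (a g x) = x := by
  rw [← RingHom.comp_apply, ← RingHom.mul_def, ← map_mul, inv_mul_cancel, map_one]; rfl

/-- The action of a group on `B` by ring endomorphisms fixing the image of `S`, as a map to the
`S`-linear endomorphisms. -/
def actEnd (g : G) : Module.End S B where
  toFun := a g
  map_add' := map_add _
  map_smul' s x := by
    rw [← smul_one_mul s x, map_mul, ha, smul_one_mul, RingHom.id_apply]

/-- The units of the opposite endomorphism ring given by the action of a group. -/
def actUnit (g : G) : ((Module.End S B)ᵐᵒᵖ)ˣ where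
  val := op (actEnd a ha g⁻¹)
  inv := op (actEnd a ha g)
  val_inv := unop_injective (LinearMap.ext fun x => map_mul_inv_apply a g x)
  inv_val := unop_injective (LinearMap.ext fun x => map_inv_mul_apply a g x)

lemma unop_actUnit_apply (g : G) (x : B) : unop (actUnit a ha g).val x = a g⁻¹ x := rfl

variable [Fintype G] [DecidableEq G] (htr : ∀ x, ∃ t : S, ∑ g, a g x = t • 1)
  {κ : Type*} (X : Finset κ) (p q : κ → B)
  (hpq : ∀ g, ∑ i ∈ X, p i * a g (q i) = if g = 1 then 1 else 0)

-- Applying `a g` to the relation for `g⁻¹` shifts the automorphism to the other factor.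
include hpq in
omit [Fintype G] in
lemma sum_map_mul_eq (g : G) : ∑ i ∈ X, a g (p i) * q i = if g = 1 then 1 else 0 := by
  have h := congrArg (a g) (hpq g⁻¹)
  simp only [map_sum, map_mul, map_mul_inv_apply, inv_eq_one] at h
  rw [h]
  split_ifs <;> simp

-- The relations make `p`, `q` a dual basis for the trace form: `x = ∑ tr(x p_i) q_i`. Traces are
-- scalars from `S`, so they pass through `f`; expanding them writes `f` as a combination of group
-- elements with coefficients in `B`.
include htr hpq in
lemma apply_eq_sum (f : Module.End S B) (x : B) :
    f x = ∑ g, a g x * ∑ i ∈ X, a g (p i) * f (q i) := by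
  have h1 : x = ∑ i ∈ X, (∑ g, a g (x * p i)) * q i := by
    simp only [Finset.sum_mul, map_mul, mul_assoc]
    rw [Finset.sum_comm]
    simp only [← Finset.mul_sum, sum_map_mul_eq a X p q hpq]
    simp
  have h2 (i : κ) : f ((∑ g, a g (x * p i)) * q i) = (∑ g, a g (x * p i)) * f (q i) := by
    obtain ⟨t, ht⟩ := htr (x * p i)
    rw [ht, smul_one_mul, map_smul, smul_one_mul]
  conv_lhs => rw [h1, map_sum]
  simp only [h2]
  simp only [Finset.sum_mul, map_mul, mul_assoc]
  rw [Finset.sum_comm]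
  simp only [Finset.mul_sum]

-- The cocycle is trivial, as the inverse in `actUnit` offsets the passage to the opposite ring;
-- spanning is `apply_eq_sum`. Here `B` takes the role of the base ring.
include htr hpq in
lemma isCrossedGroupFamily_actUnit : IsCrossedGroupFamily B (actUnit a ha) where
  conj g := by
    refine ⟨RingEquiv.ofRingHom (a g) (a g⁻¹) (RingHom.ext (map_mul_inv_apply a g))
      (RingHom.ext (map_inv_mul_apply a g)), fun b => unop_injective (LinearMap.ext fun x => ?_)⟩
    rw [unop_endOp_smul_apply, endOp_smul_def, mul_one, unop_mul, Module.End.mul_apply,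
      unop_mulRightHom_apply, unop_actUnit_apply, unop_actUnit_apply, map_mul]
    congr 1
    exact (map_inv_mul_apply a g b).symm
  mul g h := by
    refine ⟨1, unop_injective (LinearMap.ext fun x => ?_)⟩
    rw [Units.val_one, one_smul, unop_mul, Module.End.mul_apply]
    simp only [unop_actUnit_apply, mul_inv_rev, map_mul]
    rfl
  span := by
    rw [eq_top_iff]
    intro F _
    have : F = ∑ g, (a g⁻¹ (∑ i ∈ X, a g (p i) * unop F (q i))) • (actUnit a ha g⁻¹).val := by
      refine unop_injective (LinearMap.ext fun x => ?_)
      rw [apply_eq_sum a htr X p q hpq, Finset.unop_sum, LinearMap.sum_apply]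
      refine Finset.sum_congr rfl fun g _ => ?_
      rw [unop_endOp_smul_apply, unop_actUnit_apply, inv_inv, map_mul, map_mul_inv_apply]
    rw [this]
    exact Submodule.sum_mem _ fun g _ =>
      Submodule.smul_mem _ _ (Submodule.subset_span ⟨g⁻¹, rfl⟩)

-- The map sends `b • actUnit g` to `b` if `g = 1` and to `0` otherwise: it reads off the
-- coefficient at the identity, and is therefore `B`-linear.
include ha htr hpq in
lemma exists_linearMap_endOp :
    ∃ ψ : (Module.End S B)ᵐᵒᵖ →ₗ[B] B, ∀ F, ψ F = ∑ i ∈ X, p i * unop F (q i) := by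
  have hu := isCrossedGroupFamily_actUnit a ha htr X p q hpq
  refine ⟨{ toFun := fun F => ∑ i ∈ X, p i * unop F (q i), map_add' := ?_, map_smul' := ?_ },
    fun _ => rfl⟩
  · intro F F'
    simp [mul_add, Finset.sum_add_distrib]
  · intro b F
    rw [RingHom.id_apply, smul_eq_mul]
    revert b
    refine hu.induction (p := fun F => ∀ b : B,
      ∑ i ∈ X, p i * unop (b • F) (q i) = b * ∑ i ∈ X, p i * unop F (q i)) ?_ ?_ ?_ ?_ F
    · simp
    · intro F F' h h' b
      simp only [smul_add, unop_add, LinearMap.add_apply, mul_add, Finset.sum_add_distrib, h, h']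
    · intro c F h b
      rw [smul_smul, h, h, mul_assoc]
    · intro g b
      simp only [unop_endOp_smul_apply, unop_actUnit_apply, map_mul, ← mul_assoc,
        ← Finset.sum_mul, hpq]
      split_ifs with h
      · rw [h]; simp
      · simp

include ha htr hpq in
/-- The radical of a Galois extension with group of invertible order. -/
theorem jacobson_of_galois {ι : Type*} [Finite ι] (e : Module.Basis ι S B)
    (hG : IsUnit (Fintype.card G : B)) :
    (∀ b ∈ Ring.jacobson B, ∀ i, e.repr b i ∈ Ring.jacobson S) ∧
      ∀ s ∈ Ring.jacobson S, s • (1 : B) ∈ Ring.jacobson B := by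
  have hu := isCrossedGroupFamily_actUnit a ha htr X p q hpq
  refine ⟨fun b hb i => ?_, fun s hs => ?_⟩
  · have := repr_apply_mem_jacobson e (hu.smul_one_mem_jacobson hb) 1 i
    have h1 : unop (b • (1 : (Module.End S B)ᵐᵒᵖ)) 1 = b := one_mul b
    rwa [← h1]
  · have : Module.Finite S B := Module.Finite.of_basis e
    have : Module.Free S B := Module.Free.of_basis e
    -- This is `x ↦ tr(x) s`, with values in the radical multiples of `B`, so it lies in the radical
    -- of the endomorphism ring. By Maschke it also lies in the radical of that ring as a
    -- `B`-module, and `ψ` maps it to `s`.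
    let f : Module.End S B := ∑ g, unop (mulRightHom S B (s • 1)) * actEnd a ha g
    have hf1 (x : B) : f x = ∑ g, a g x * (s • 1) := by
      simp [f, unop_mulRightHom_apply]
      rfl
    have hf : op f ∈ Ring.jacobson (Module.End S B)ᵐᵒᵖ := by
      refine op_mem_jacobson_of_forall_mem fun x => ?_
      obtain ⟨t, ht⟩ := htr x
      rw [hf1, ← Finset.sum_mul, ht, smul_one_mul, smul_smul]
      exact Submodule.smul_mem_smul (Ideal.mul_mem_left _ _ hs) trivial
    have hG' : IsUnit (Fintype.card G : (Module.End S B)ᵐᵒᵖ) := by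
      rw [← map_natCast (mulRightHom S B)]
      exact hG.map _
    obtain ⟨ψ, hψ⟩ := exists_linearMap_endOp a ha htr X p q hpq
    have := Module.le_comap_jacobson ψ (hu.jacobson_le_jacobson hG' _ hf)
    rw [Submodule.mem_comap, hψ] at this
    convert this using 1
    simp only [unop_op, hf1, Finset.mul_sum, ← mul_assoc]
    rw [Finset.sum_comm]
    simp only [← Finset.sum_mul, hpq]
    simp

end EndJacobson

/-! ### Left integrals, separability and finite dimension -/

section Integrals

open Coalgebra

variable {k : Type*} [Field k]

/-- In the expansion of `x` along a basis of `W` the coefficients are the slices by the coordinate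
forms. -/
lemma mem_range_rTensor_of_forall_slice {V W : Type*} [AddCommGroup V] [Module k V]
    [AddCommGroup W] [Module k W] (U : Submodule k V) (x : V ⊗[k] W)
    (hx : ∀ η : W →ₗ[k] k, TensorProduct.rid k V (η.lTensor V x) ∈ U) :
    x ∈ LinearMap.range (U.subtype.rTensor W) := by
  classical
  let b := Module.Basis.ofVectorSpace k W
  rw [← (TensorProduct.equivFinsuppOfBasisRight b).symm_apply_apply x,
    TensorProduct.equivFinsuppOfBasisRight_symm_apply]
  refine Submodule.sum_mem _ fun i _ => ?_
  simp only [TensorProduct.equivFinsuppOfBasisRight_apply]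
  exact ⟨⟨_, hx (b.coord i)⟩ ⊗ₜ b i, rfl⟩

/-- If `(h ⊗ 1) e = e (1 ⊗ h)` for all `h`, and `e` multiplies to `1`, then the algebra is
finite-dimensional. -/
lemma finite_of_separability {A : Type*} [Ring A] [Algebra k A] (e : A ⊗[k] A)
    (he : ∀ h : A, (h ⊗ₜ[k] (1 : A)) * e = e * ((1 : A) ⊗ₜ[k] h))
    (he1 : LinearMap.mul' k A e = 1) : Module.Finite k A := by
  classical
  let sl (η : A →ₗ[k] k) : A ⊗[k] A →ₗ[k] A := (TensorProduct.rid k A).toLinearMap ∘ₗ η.lTensor A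
  have sl_tmul (η : A →ₗ[k] k) (a b : A) : sl η (a ⊗ₜ b) = η b • a := by simp [sl]
  -- The slices of `e` span a finite-dimensional left ideal: multiplying a slice by `h` amounts to
  -- replacing `η` by `η(· h)`.
  let V : Submodule k A := Submodule.span k (Set.range fun η => sl η e)
  have hV : V.FG := by
    obtain ⟨T, hT⟩ := TensorProduct.exists_finset e
    refine Submodule.FG.of_le (S := V) (T := Submodule.span k (T.image Prod.fst : Set A))
      (Submodule.fg_span (Finset.finite_toSet _)) ?_
    rw [Submodule.span_le]
    rintro _ ⟨η, rfl⟩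
    simp only [hT, map_sum, sl_tmul]
    refine Submodule.sum_mem _ fun i hi => Submodule.smul_mem _ _ (Submodule.subset_span ?_)
    exact Finset.mem_coe.2 (Finset.mem_image_of_mem _ hi)
  have hmul (h v : A) (hv : v ∈ V) : h * v ∈ V := by
    induction hv using Submodule.span_induction with
    | zero => simp
    | add x y _ _ hx hy => rw [mul_add]; exact V.add_mem hx hy
    | smul c x _ hx => rw [mul_smul_comm]; exact V.smul_mem _ hx
    | mem x hx =>
      obtain ⟨η, rfl⟩ := hx
      have h1 (z : A ⊗[k] A) : h * sl η z = sl η ((h ⊗ₜ[k] (1 : A)) * z) := by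
        induction z with
        | zero => simp
        | add x y hx hy => simp only [map_add, mul_add, hx, hy]
        | tmul x y => simp [sl_tmul]
      have h2 (z : A ⊗[k] A) : sl η (z * ((1 : A) ⊗ₜ[k] h)) =
          sl (η ∘ₗ LinearMap.mulRight k h) z := by
        induction z with
        | zero => simp
        | add x y hx hy => simp only [map_add, add_mul, hx, hy]
        | tmul x y => simp [sl_tmul]
      simp only [h1, he, h2]
      exact Submodule.subset_span ⟨_, rfl⟩
  obtain ⟨z, hz⟩ := mem_range_rTensor_of_forall_slice V e fun η =>
    Submodule.subset_span ⟨η, rfl⟩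
  obtain ⟨T, hT⟩ := TensorProduct.exists_finset z
  let Y : Submodule k A := Submodule.span k (T.image Prod.snd : Set A)
  have hY : Y.FG := Submodule.fg_span (Finset.finite_toSet _)
  -- Write `e` as a sum of `v ⊗ y` with `v` in `V` and `y` in `Y`. Then `h` is the sum of the `(h v)
  -- y`, and `h v` stays in `V`.
  have htop : V * Y = ⊤ := by
    rw [eq_top_iff]
    intro h _
    have h1 : h = ∑ i ∈ T, h * (i.1 : A) * i.2 := by
      conv_lhs => rw [← mul_one h, ← he1, ← hz, hT]
      simp [Finset.mul_sum, mul_assoc]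
    rw [h1]
    refine Submodule.sum_mem _ fun i hi => Submodule.mul_mem_mul (hmul _ _ i.1.2) ?_
    exact Submodule.subset_span (Finset.mem_coe.2 (Finset.mem_image_of_mem _ hi))
  exact ⟨htop ▸ hV.mul hY⟩

variable {H : Type*} [Ring H] [HopfAlgebra k H]

-- The augmentation ideal has a complementary left ideal `L`; take the component of `1` in it. The
-- product `(h - ε(h)) Λ` lies both in `L` and in the augmentation ideal, so it is zero.
variable (k H) in
lemma exists_left_integral [IsSemisimpleRing H] :
    ∃ Λ : H, (∀ h, h * Λ = counit (R := k) h • Λ) ∧ counit (R := k) Λ = 1 := by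
  let ε := Bialgebra.counitAlgHom k H
  obtain ⟨L, hL⟩ := exists_isCompl (RingHom.ker ε : Submodule H H)
  have h1 : (1 : H) ∈ (RingHom.ker ε : Submodule H H) ⊔ L := by
    rw [hL.sup_eq_top]; trivial
  obtain ⟨e, he, Λ, hΛ, h⟩ := Submodule.mem_sup.1 h1
  have he' : ε e = 0 := he
  refine ⟨Λ, fun x => ?_, ?_⟩
  · rw [← sub_eq_zero, ← Submodule.mem_bot H, ← hL.inf_eq_bot]
    rw [Algebra.smul_def, ← sub_mul]
    refine ⟨?_, L.smul_mem _ hΛ⟩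
    change ε _ = 0
    rw [map_mul, map_sub, AlgHom.commutes]
    simp [ε]
  · have := congrArg ε h
    rw [map_add, he', zero_add, map_one] at this
    exact this

open HopfAlgebra in
/-- The separability idempotent given by a left integral. -/
lemma tmul_one_mul_of_left_integral {Λ : H} (hΛ : ∀ h, h * Λ = counit (R := k) h • Λ) (h : H) :
    (h ⊗ₜ[k] (1 : H)) * (antipode k).lTensor H (comul (R := k) Λ) =
      (antipode k).lTensor H (comul (R := k) Λ) * ((1 : H) ⊗ₜ[k] h) := by
  set e := (antipode k).lTensor H (comul (R := k) Λ) with he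
  let i₁ : H →ₐ[k] H ⊗[k] H := Algebra.TensorProduct.includeLeft
  let i₂ : H →ₐ[k] H ⊗[k] H := Algebra.TensorProduct.includeRight
  let P : H →ₗ[k] H ⊗[k] H := LinearMap.mulRight k e ∘ₗ i₁.toLinearMap
  -- Applying the antipode to the second leg of Δ(xΛ) = ε(x)Δ(Λ) gives ∑ (x₁ ⊗ 1) e (1 ⊗ S x₂) =
  -- ε(x) e. Convolving with `i₂` then removes the antipode.
  have key : toConv (LinearMap.mulLeft k e ∘ₗ Algebra.linearMap k _ ∘ₗ counit) =
      toConv P * toConv (i₂.toLinearMap ∘ₗ antipode k) := by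
    ext x
    rw [(ℛ k x).convMul_apply]
    have h1 : (antipode k).lTensor H (comul (R := k) (x * Λ)) = counit (R := k) x • e := by
      rw [hΛ, map_smul, map_smul]
    have h2 (a b : H) (z : H ⊗[k] H) : (antipode k).lTensor H ((a ⊗ₜ[k] b) * z) =
        (a ⊗ₜ[k] (1 : H)) * (antipode k).lTensor H z * ((1 : H) ⊗ₜ[k] antipode k b) := by
      induction z with
      | zero => simp
      | add x y hx hy => simp only [map_add, mul_add, add_mul, hx, hy]
      | tmul x y => simp [antipode_mul_antidistrib]
    rw [Bialgebra.comul_mul, ← (ℛ k x).eq, Finset.sum_mul, map_sum] at h1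
    simp only [h2] at h1
    simp only [P, i₁, i₂, LinearMap.comp_apply, LinearMap.mulLeft_apply, LinearMap.mulRight_apply,
      Algebra.linearMap_apply, AlgHom.toLinearMap_apply,
      Algebra.TensorProduct.includeLeft_apply, Algebra.TensorProduct.includeRight_apply]
    rw [he, h1, Algebra.algebraMap_eq_smul_one, mul_smul_comm, mul_one]
  have hinv : toConv (i₂.toLinearMap ∘ₗ antipode k) * toConv i₂.toLinearMap = 1 := by
    have := CrossedSystem.comp_conv i₂ (toConv (antipode k)) (toConv LinearMap.id)
    rw [LinearMap.antipode_mul_id] at this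
    refine Eq.trans this.symm ?_
    ext x
    simp
  have h3 := congrArg (· * toConv i₂.toLinearMap) key
  simp only [mul_assoc, hinv, mul_one] at h3
  have h4 := congrArg (fun f => f.ofConv h) h3
  simp only at h4
  rw [(ℛ k h).convMul_apply] at h4
  change _ = (h ⊗ₜ[k] (1 : H)) * e at h4
  rw [← h4]
  conv_rhs => rw [← sum_counit_smul (ℛ k h)]
  simp [TensorProduct.tmul_sum, Finset.mul_sum, Algebra.algebraMap_eq_smul_one, i₂]

open HopfAlgebra in
lemma mul'_lTensor_antipode_comul (Λ : H) :
    LinearMap.mul' k H ((antipode k).lTensor H (comul (R := k) Λ)) =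
      algebraMap k H (counit (R := k) Λ) := mul_antipode_lTensor_comul_apply Λ

variable (k H) in
lemma finite_of_isSemisimpleRing [IsSemisimpleRing H] : Module.Finite k H := by
  obtain ⟨Λ, h1, h2⟩ := exists_left_integral k H
  exact finite_of_separability _ (tmul_one_mul_of_left_integral h1)
    (by rw [mul'_lTensor_antipode_comul, h2, map_one])

end Integrals

/-! ### The integral on a cosemisimple Hopf algebra -/

section DualIntegral

open Coalgebra

variable {k H : Type*} [Field k] [Ring H] [HopfAlgebra k H]

/-- A linear form that is a left and a right integral of the dual algebra, normalized at `1`. -/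
structure IsDualIntegral (k : Type*) {H : Type*} [Field k] [Ring H] [HopfAlgebra k H]
    (lam : H →ₗ[k] k) : Prop where
  left : ∀ z, TensorProduct.rid k H (lam.lTensor H (comul z)) = lam z • 1
  right : ∀ z, TensorProduct.lid k H (lam.rTensor H (comul z)) = lam z • 1
  one : lam 1 = 1

variable (k) in
lemma isSubcoalgebra_span_one : IsSubcoalgebra k (Submodule.span k {(1 : H)}) := by
  intro x hx
  obtain ⟨c, rfl⟩ := Submodule.mem_span_singleton.1 hx
  rw [map_smul]
  refine Submodule.smul_mem _ _ ⟨⟨1, Submodule.mem_span_singleton_self 1⟩ ⊗ₜ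
    ⟨1, Submodule.mem_span_singleton_self 1⟩, ?_⟩
  rw [TensorProduct.map_tmul, Bialgebra.comul_one]
  rfl

lemma IsSubcoalgebra.mul'_map_comul_left_eq_zero {C A : Type*} [AddCommGroup C] [Module k C]
    [Coalgebra k C] [Ring A] [Algebra k A] {D : Submodule k C}
    (hD : IsSubcoalgebra k D) (f g : WithConv (C →ₗ[k] A)) (hf : ∀ x ∈ D, f.ofConv x = 0)
    {x : C} (hx : x ∈ D) : (f * g).ofConv x = 0 ∧ (g * f).ofConv x = 0 := by
  obtain ⟨z, hz⟩ := hD x hx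
  change LinearMap.mul' k A (TensorProduct.map f.ofConv g.ofConv (comul x)) = 0 ∧
    LinearMap.mul' k A (TensorProduct.map g.ofConv f.ofConv (comul x)) = 0
  rw [← hz]
  clear hz
  induction z with
  | zero => simp
  | add a b ha hb => simp [ha.1, ha.2, hb.1, hb.2]
  | tmul a b => simp [hf a a.2, hf b b.2]

lemma exists_form_of_not_mem {C : Type*} [AddCommGroup C] [Module k C]
    {D : Submodule k C} {x : C} (hx : x ∉ D) : ∃ f : C →ₗ[k] k, (∀ y ∈ D, f y = 0) ∧ f x = 1 := by
  obtain ⟨f, hf, hD⟩ := Submodule.exists_le_ker_of_notMem hx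
  refine ⟨(f x)⁻¹ • f, fun y hy => ?_, ?_⟩
  · simp [LinearMap.mem_ker.1 (hD hy)]
  · simp [inv_mul_cancel₀ hf]

/-- A convolution product vanishes on every subcoalgebra killed by one of its factors, while its
value at the group-like `1` is the product of the values. So one form per subcoalgebra is enough. -/
lemma exists_form_one_eq_one (T : Finset (Submodule k H))
    (hT : ∀ D ∈ T, IsSubcoalgebra k D ∧ (1 : H) ∉ D) :
    ∃ f : WithConv (H →ₗ[k] k), f.ofConv 1 = 1 ∧ ∀ D ∈ T, ∀ x ∈ D, f.ofConv x = 0 := by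
  classical
  induction T using Finset.induction_on with
  | empty => exact ⟨1, by simp, by simp⟩
  | insert D T _ ih =>
    obtain ⟨g, hg1, hg⟩ := ih fun D' hD' => hT D' (Finset.mem_insert_of_mem hD')
    obtain ⟨hD, h1D⟩ := hT D (Finset.mem_insert_self _ _)
    obtain ⟨f, hf, hf1⟩ := exists_form_of_not_mem h1D
    refine ⟨toConv f * g, ?_, fun D' hD' x hx => ?_⟩
    · simp [Bialgebra.comul_one, Algebra.TensorProduct.one_def, hf1, hg1]
    · rcases Finset.mem_insert.1 hD' with rfl | h
      · exact (hD.mul'_map_comul_left_eq_zero (toConv f) g hf hx).1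
      · exact ((hT D' hD').1.mul'_map_comul_left_eq_zero g (toConv f) (hg D' h) hx).2

-- Take a form that is `1` at `1` and zero on all simple subcoalgebras other than the line of `1`.
-- On such a `D` both sides of each integral identity vanish because Δ(D) ⊆ D ⊗ D.
variable (k H) in
lemma exists_isDualIntegral (hH : IsCosemisimpleCoalgebra k H) :
    ∃ lam : H →ₗ[k] k, IsDualIntegral k lam := by
  set N := Submodule.span k {(1 : H)} with hN
  let 𝒮 := {D : Submodule k H | IsSimpleSubcoalgebra k D}
  let E := sSup (𝒮 \ {N})
  have h1 (D : Submodule k H) (hD : D ∈ 𝒮 \ {N}) : IsSubcoalgebra k D ∧ (1 : H) ∉ D := by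
    refine ⟨hD.1.1, fun h => ?_⟩
    have hle : N ≤ D := (Submodule.span_singleton_le_iff_mem _ _).2 h
    rcases hD.1.2.2 N (isSubcoalgebra_span_one k) hle with h0 | h0
    · have : (1 : H) = 0 := Submodule.span_singleton_eq_bot.1 (hN ▸ h0)
      have h2 := congrArg (counit (R := k)) this
      simp at h2
    · exact hD.2 h0.symm
  have hE : (1 : H) ∉ E := by
    intro h
    obtain ⟨T, hT, hmem⟩ := Submodule.mem_sSup_iff_exists_finset.1 h
    obtain ⟨f, hf1, hf⟩ := exists_form_one_eq_one T fun D hD => h1 D (hT hD)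
    have : (⨆ D ∈ T, D) ≤ LinearMap.ker f.ofConv := iSup₂_le fun D hD x hx => hf D hD x hx
    have h0 : f.ofConv 1 = 0 := this hmem
    rw [hf1] at h0
    exact one_ne_zero h0
  obtain ⟨lam, hlam, hlam1⟩ := exists_form_of_not_mem hE
  have key (z : H) : TensorProduct.rid k H (lam.lTensor H (comul z)) = lam z • 1 ∧
      TensorProduct.lid k H (lam.rTensor H (comul z)) = lam z • 1 := by
    let W : Submodule k H :=
      LinearMap.ker ((TensorProduct.rid k H).toLinearMap ∘ₗ lam.lTensor H ∘ₗ comul -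
        LinearMap.toSpanSingleton k H 1 ∘ₗ lam) ⊓
      LinearMap.ker ((TensorProduct.lid k H).toLinearMap ∘ₗ lam.rTensor H ∘ₗ comul -
        LinearMap.toSpanSingleton k H 1 ∘ₗ lam)
    have hW : W = ⊤ := by
      rw [eq_top_iff, ← hH]
      refine sSup_le fun D hD x hx => ?_
      by_cases hDN : D = N
      · rw [hDN] at hx
        obtain ⟨c, rfl⟩ := Submodule.mem_span_singleton.1 hx
        refine W.smul_mem c ⟨?_, ?_⟩ <;>
          simp [Bialgebra.comul_one, Algebra.TensorProduct.one_def, hlam1]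
      · have hlD (y : H) (hy : y ∈ D) : lam y = 0 :=
          hlam y (le_sSup (a := D) (s := 𝒮 \ {N}) ⟨hD, hDN⟩ hy)
        obtain ⟨t, ht⟩ := hD.1 x hx
        refine ⟨?_, ?_⟩
        all_goals
          simp only [LinearMap.mem_ker, SetLike.mem_coe, LinearMap.sub_apply, LinearMap.comp_apply,
            hlD x hx, ← ht, map_zero, sub_zero]
          clear ht
          induction t with
          | zero => simp
          | add a b ha hb => simp only [map_add, ha, hb, add_zero]
          | tmul a b => simp [hlD a a.2, hlD b b.2]
    have hz : z ∈ W := hW ▸ trivial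
    exact ⟨sub_eq_zero.1 hz.1, sub_eq_zero.1 hz.2⟩
  exact ⟨lam, fun z => (key z).1, fun z => (key z).2, hlam1⟩

end DualIntegral

/-! ### Characters of a commutative semisimple Hopf algebra -/

section Characters

open Coalgebra

/-- All residue fields equal `F`, so `x` lies in every maximal ideal; in an Artinian ring their
intersection is the nilradical, here zero. -/
lemma eq_zero_of_forall_algHom_eq_zero {F K : Type*} [Field F] [IsAlgClosed F] [CommRing K]
    [Algebra F K] [Module.Finite F K] [IsReduced K] (x : K) (hx : ∀ ψ : K →ₐ[F] F, ψ x = 0) :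
    x = 0 := by
  have : IsArtinianRing K := isArtinian_of_tower F inferInstance
  have hmem : x ∈ Ring.jacobson K := by
    rw [Ring.jacobson_eq_sInf_isMaximal, Submodule.mem_sInf]
    intro (m : Ideal K) (hm : m.IsMaximal)
    have hbij : Function.Bijective (algebraMap F (K ⧸ m)) :=
      IsAlgClosed.algebraMap_bijective_of_isIntegral
    let e : F ≃ₐ[F] (K ⧸ m) := AlgEquiv.ofBijective (Algebra.ofId F (K ⧸ m)) hbij
    have h := hx (e.symm.toAlgHom.comp (Ideal.Quotient.mkₐ F m))
    have h' : Ideal.Quotient.mkₐ F m x = 0 := by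
      refine e.symm.injective ?_
      rw [map_zero]
      exact h
    exact Ideal.Quotient.eq_zero_iff_mem.1 h'
  rw [Ring.jacobson_eq_nilradical_of_krullDimLE_zero] at hmem
  exact (mem_nilradical.1 hmem).eq_zero

lemma span_algHom_eq_top (F K : Type*) [Field F] [IsAlgClosed F] [CommRing K]
    [Algebra F K] [Module.Finite F K] [IsReduced K] :
    Submodule.span F (Set.range fun ψ : K →ₐ[F] F => ψ.toLinearMap) = ⊤ := by
  set W : Submodule F (Module.Dual F K) :=
    Submodule.span F (Set.range fun ψ : K →ₐ[F] F => ψ.toLinearMap) with hW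
  have h : W.dualCoannihilator = ⊥ := by
    rw [eq_bot_iff]
    intro x hx
    refine eq_zero_of_forall_algHom_eq_zero (F := F) x fun ψ => ?_
    exact (Submodule.mem_dualCoannihilator x).1 hx _ (Submodule.subset_span ⟨ψ, rfl⟩)
  have h2 : W.dualCoannihilator.dualAnnihilator = W :=
    Subspace.dualCoannihilator_dualAnnihilator_eq (W := W)
  rw [h, Submodule.dualAnnihilator_bot] at h2
  exact h2.symm

lemma exists_apply_eq_ite {F V G : Type*} [Field F] [AddCommGroup V] [Module F V] [Fintype G]
    [DecidableEq G] {f : G → V →ₗ[F] F} (hf : LinearIndependent F f) (g₀ : G) :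
    ∃ v, ∀ g, f g v = if g = g₀ then 1 else 0 := by
  have hsurj : LinearMap.range (LinearMap.pi f) = ⊤ := by
    by_contra hne
    obtain ⟨φ, hφ, hle⟩ := Submodule.exists_le_ker_of_lt_top _ (lt_top_iff_ne_top.2 hne)
    have hsum : ∑ g, φ (Pi.single g 1) • f g = 0 := by
      ext v
      have h1 : φ (LinearMap.pi f v) = 0 := hle ⟨v, rfl⟩
      have hs (g : G) : (fun j => if g = j then (1 : F) else 0) = Pi.single g 1 := by
        ext j
        simp [Pi.single_apply, eq_comm]
      rw [LinearMap.pi_apply_eq_sum_univ] at h1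
      simpa [hs, mul_comm] using h1
    refine hφ (LinearMap.pi_ext' fun g => LinearMap.ext_ring ?_)
    exact Fintype.linearIndependent_iff.1 hf _ hsum g
  obtain ⟨v, hv⟩ := LinearMap.range_eq_top.1 hsurj fun g => if g = g₀ then 1 else 0
  exact ⟨v, fun g => congrFun hv g⟩

variable {k H F : Type*} [Field k] [CommRing H] [HopfAlgebra k H] [Field F] [Algebra k F]

/-- The characters of a commutative Hopf algebra form a group under convolution. -/
noncomputable abbrev characterGroup (k H F : Type*) [Field k] [CommRing H] [HopfAlgebra k H]
    [Field F] [Algebra k F] : Group (WithConv (H →ₐ[k] F)) where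
  __ := (inferInstance : Monoid (WithConv (H →ₐ[k] F)))
  inv f := toConv (f.ofConv.comp (HopfAlgebra.antipodeAlgHom k H))
  inv_mul_cancel f := by
    apply WithConv.ofConv_injective
    apply AlgHom.toLinearMap_injective
    apply WithConv.toConv_injective
    rw [AlgHom.toLinearMap_convMul, AlgHom.toLinearMap_convOne]
    have h := CrossedSystem.comp_conv f.ofConv (toConv (HopfAlgebra.antipode k (A := H)))
      (toConv LinearMap.id)
    rw [LinearMap.antipode_mul_id] at h
    refine Eq.trans h.symm ?_
    ext x
    simp

attribute [local instance] characterGroup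

-- The separability idempotent of the integral is the required witness. Unramifiedness is wanted
-- because it makes `F ⊗ H` reduced.
variable (k H) in
lemma formallyUnramified_of_isSemisimpleRing [IsSemisimpleRing H] :
    Algebra.FormallyUnramified k H := by
  have := finite_of_isSemisimpleRing k H
  obtain ⟨Λ, h1, h2⟩ := exists_left_integral k H
  rw [Algebra.FormallyUnramified.iff_exists_tensorProduct]
  refine ⟨(HopfAlgebra.antipode k).lTensor H (comul (R := k) Λ), fun s => ?_, ?_⟩
  · rw [sub_mul, tmul_one_mul_of_left_integral h1, mul_comm, sub_self]
  · rw [← map_one (algebraMap k H), ← h2, ← mul'_lTensor_antipode_comul]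
    rfl

variable (k H F) in
lemma span_characters [IsAlgClosed F] [IsSemisimpleRing H] :
    Submodule.span F (Set.range fun χ : WithConv (H →ₐ[k] F) => χ.ofConv.toLinearMap) = ⊤ := by
  have := finite_of_isSemisimpleRing k H
  have := formallyUnramified_of_isSemisimpleRing k H
  have hred : IsReduced (F ⊗[k] H) := Algebra.FormallyUnramified.isReduced_of_field F (F ⊗[k] H)
  let res : (F ⊗[k] H →ₗ[F] F) →ₗ[F] (H →ₗ[k] F) :=
    { toFun := fun f => f.restrictScalars k ∘ₗ
        (Algebra.TensorProduct.includeRight : H →ₐ[k] F ⊗[k] H).toLinearMap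
      map_add' := fun _ _ => rfl
      map_smul' := fun _ _ => rfl }
  have hres : LinearMap.range res = ⊤ := by
    refine LinearMap.range_eq_top.2 fun f => ⟨TensorProduct.AlgebraTensorModule.lift
      ((LinearMap.lsmul F (H →ₗ[k] F)).flip f), ?_⟩
    ext h
    simp [res]
  rw [eq_top_iff, ← hres, ← Submodule.map_top, ← span_algHom_eq_top F (F ⊗[k] H),
    Submodule.map_span, Submodule.span_le]
  rintro _ ⟨_, ⟨ψ, rfl⟩, rfl⟩
  exact Submodule.subset_span
    ⟨toConv ((ψ.restrictScalars k).comp Algebra.TensorProduct.includeRight), rfl⟩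

variable (k H F) in
lemma finite_characters [IsSemisimpleRing H] : Finite (WithConv (H →ₐ[k] F)) := by
  have := finite_of_isSemisimpleRing k H
  have : Finite (H →ₐ[k] F) := inferInstance
  exact Finite.of_injective _ WithConv.ofConv_injective

/-- The sum `μ` of all characters is fixed by convolution with a character; as characters span, `f *
μ = f(1) μ` for every form `f`. For `f = lam` this is `μ`, whereas the integral property gives `μ(1)
lam`. Were the order zero in `F`, `μ` would vanish, against independence of characters. -/
lemma sum_characters [IsAlgClosed F] [IsSemisimpleRing H] [Fintype (WithConv (H →ₐ[k] F))]
    {lam : H →ₗ[k] k} (hlam : IsDualIntegral k lam) :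
    (Fintype.card (WithConv (H →ₐ[k] F)) : F) ≠ 0 ∧
      ∀ h, ∑ χ : WithConv (H →ₐ[k] F), χ.ofConv h =
        Fintype.card (WithConv (H →ₐ[k] F)) * algebraMap k F (lam h) := by
  set μ : H →ₗ[k] F := ∑ χ : WithConv (H →ₐ[k] F), χ.ofConv.toLinearMap with hμ
  have hμ1 : μ 1 = Fintype.card (WithConv (H →ₐ[k] F)) := by simp [hμ]
  have hinv (χ : WithConv (H →ₐ[k] F)) : toConv χ.ofConv.toLinearMap * toConv μ = toConv μ := by
    have h1 : toConv μ = ∑ ψ : WithConv (H →ₐ[k] F), toConv ψ.ofConv.toLinearMap := by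
      rw [hμ, WithConv.toConv_sum]
    rw [h1, Finset.mul_sum]
    refine Fintype.sum_equiv (Equiv.mulLeft χ) _ _ fun ψ => ?_
    rw [Equiv.coe_mulLeft, AlgHom.toLinearMap_convMul]
  have hspan (f : H →ₗ[k] F) : toConv f * toConv μ = f 1 • toConv μ := by
    have hf : f ∈ Submodule.span F
        (Set.range fun χ : WithConv (H →ₐ[k] F) => χ.ofConv.toLinearMap) := by
      rw [span_characters]; trivial
    induction hf using Submodule.span_induction with
    | zero => simp
    | add x y _ _ hx hy => rw [WithConv.toConv_add, add_mul, hx, hy, LinearMap.add_apply, add_smul]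
    | smul c x _ hx =>
      rw [WithConv.toConv_smul, smul_mul_assoc, hx, LinearMap.smul_apply, smul_smul, smul_eq_mul]
    | mem x hx =>
      obtain ⟨χ, rfl⟩ := hx
      rw [hinv]
      simp
  have hlamμ (h : H) : μ h = Fintype.card (WithConv (H →ₐ[k] F)) * algebraMap k F (lam h) := by
    have h1 := congrArg (fun f => f.ofConv h) (hspan (Algebra.linearMap k F ∘ₗ lam))
    simp only [LinearMap.comp_apply, hlam.one, Algebra.linearMap_apply, map_one, one_smul] at h1
    rw [← h1, (ℛ k h).convMul_apply]
    have h2 := hlam.right h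
    rw [← (ℛ k h).eq] at h2
    simp only [map_sum, LinearMap.rTensor_tmul, TensorProduct.lid_tmul] at h2
    have h3 := congrArg μ h2
    simp only [map_sum, map_smul, hμ1] at h3
    simp only [Algebra.smul_def] at h3
    rw [mul_comm, ← h3]
    rfl
  refine ⟨fun h0 => ?_, fun h => ?_⟩
  · have hzero : μ = 0 := by
      ext h
      rw [hlamμ, h0, zero_mul, LinearMap.zero_apply]
    have hli := (linearIndependent_algHom_toLinearMap k H F).comp
      (WithConv.ofConv : WithConv (H →ₐ[k] F) → _) WithConv.ofConv_injective
    have := Fintype.linearIndependent_iff.1 hli (fun _ => 1)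
      (by simpa [hμ] using hzero) 1
    exact one_ne_zero this
  · rw [← hlamμ]
    simp [hμ]

end Characters

/-! ### The antipode and the integral identity behind dual separability -/

section GroupLikes

open Coalgebra HopfAlgebra

variable {k H : Type*} [Field k] [Ring H] [HopfAlgebra k H]

-- Both sides are convolution inverses of the comultiplication.
variable (k H) in
lemma comul_comp_antipode :
    toConv (comul ∘ₗ antipode k (A := H)) =
      toConv ((Algebra.TensorProduct.includeRight : H →ₐ[k] H ⊗[k] H).toLinearMap ∘ₗ antipode k) *
      toConv ((Algebra.TensorProduct.includeLeft : H →ₐ[k] H ⊗[k] H).toLinearMap ∘ₗ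
        antipode k) := by
  set i₁ : H →ₐ[k] H ⊗[k] H := Algebra.TensorProduct.includeLeft
  set i₂ : H →ₐ[k] H ⊗[k] H := Algebra.TensorProduct.includeRight
  have hinv (i : H →ₐ[k] H ⊗[k] H) :
      toConv (i.toLinearMap ∘ₗ antipode k) * toConv i.toLinearMap = 1 := by
    have := CrossedSystem.comp_conv i (toConv (antipode k)) (toConv LinearMap.id)
    rw [LinearMap.antipode_mul_id] at this
    refine Eq.trans this.symm ?_
    ext x
    simp
  have hcomul : toConv (comul (R := k) (A := H)) = toConv i₁.toLinearMap * toConv i₂.toLinearMap := by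
    ext x
    rw [(ℛ k x).convMul_apply]
    conv_lhs => rw [← (ℛ k x).eq]
    simp [i₁, i₂]
  refine (left_inv_eq_right_inv (a := toConv (comul (R := k) (A := H))) ?_
    LinearMap.comul_right_inv).symm
  rw [hcomul, mul_assoc, ← mul_assoc (toConv (i₁.toLinearMap ∘ₗ _)), hinv, one_mul, hinv]

/-- The integral property at `x S(y)` reads λ(x S(y)) 1 = ∑ λ(x₂ S(y₁)) x₁ S(y₂), a convolution with
the antipode in the variable `y`. Convolving with the identity cancels the antipode. -/
lemma IsDualIntegral.slice_mul_antipode {lam : H →ₗ[k] k} (hlam : IsDualIntegral k lam) (x y : H) :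
    ∑ i ∈ (ℛ k x).index, lam ((ℛ k x).right i * antipode k y) • (ℛ k x).left i =
      ∑ i ∈ (ℛ k y).index, lam (x * antipode k ((ℛ k y).left i)) • (ℛ k y).right i := by
  let sl : H ⊗[k] H →ₗ[k] H := (TensorProduct.rid k H).toLinearMap ∘ₗ lam.lTensor H
  have sl_tmul (a b : H) : sl (a ⊗ₜ b) = lam b • a := by simp [sl]
  have sl_mul (z : H ⊗[k] H) (a : H) : sl (z * (a ⊗ₜ[k] (1 : H))) = sl z * a := by
    induction z with
    | zero => simp
    | add x y hx hy => simp only [map_add, add_mul, hx, hy]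
    | tmul x y => simp [sl_tmul]
  let Q : H →ₗ[k] H := sl ∘ₗ LinearMap.mulLeft k (comul x) ∘ₗ
    (Algebra.TensorProduct.includeRight : H →ₐ[k] H ⊗[k] H).toLinearMap ∘ₗ antipode k
  let Z : H →ₗ[k] H := LinearMap.toSpanSingleton k H 1 ∘ₗ lam ∘ₗ LinearMap.mulLeft k x ∘ₗ antipode k
  have hZ : toConv Z = toConv Q * toConv (antipode k) := by
    ext y
    have h1 : Z y = sl (comul (x * antipode k y)) := (hlam.left _).symm
    have h2 := congrArg (fun f => f.ofConv y) (comul_comp_antipode k H)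
    simp only [LinearMap.comp_apply] at h2
    rw [(ℛ k y).convMul_apply] at h2
    rw [(ℛ k y).convMul_apply]
    change Z y = _
    rw [h1, Bialgebra.comul_mul, h2, Finset.mul_sum, map_sum]
    refine Finset.sum_congr rfl fun i _ => ?_
    rw [← mul_assoc]
    exact sl_mul _ _
  have h3 : toConv Z * toConv LinearMap.id = toConv Q := by
    rw [hZ, mul_assoc, LinearMap.antipode_mul_id, mul_one]
  have h4 := congrArg (fun f => f.ofConv y) h3
  simp only at h4
  rw [(ℛ k y).convMul_apply] at h4
  refine Eq.trans ?_ (h4.symm.trans ?_)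
  · simp only [Q, LinearMap.comp_apply, LinearMap.mulLeft_apply]
    conv_rhs => rw [← (ℛ k x).eq]
    simp [Finset.sum_mul, sl_tmul]
  · simp [Z]

end GroupLikes

/-! ### The dual algebra and group-like elements -/

section DualAlgebra

open Coalgebra HopfAlgebra

variable {k H : Type*} [Field k] [Ring H] [HopfAlgebra k H] [Module.Finite k H]

/-- The identification of the tensor square of the dual algebra with the dual of the tensor
square. -/
noncomputable def convDistrib (k H : Type*) [Field k] [Ring H] [HopfAlgebra k H]
    [Module.Finite k H] :
    WithConv (H →ₗ[k] k) ⊗[k] WithConv (H →ₗ[k] k) ≃ₗ[k] Module.Dual k (H ⊗[k] H) :=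
  (TensorProduct.congr (WithConv.linearEquiv k _) (WithConv.linearEquiv k _)).trans
    (TensorProduct.dualDistribEquiv k H H)

lemma convDistrib_tmul (f g : WithConv (H →ₗ[k] k)) (x y : H) :
    convDistrib k H (f ⊗ₜ g) (x ⊗ₜ y) = f.ofConv x * g.ofConv y := rfl

variable [IsCocomm k H]

omit [Module.Finite k H] [IsCocomm k H] in
lemma convTensor_mul_add (x y z : WithConv (H →ₗ[k] k) ⊗[k] WithConv (H →ₗ[k] k)) :
    x * (y + z) = x * y + x * z :=
  map_add (Algebra.TensorProduct.mul x) y z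

omit [Module.Finite k H] [IsCocomm k H] in
lemma convTensor_mul_zero (x : WithConv (H →ₗ[k] k) ⊗[k] WithConv (H →ₗ[k] k)) : x * 0 = 0 :=
  map_zero (Algebra.TensorProduct.mul x)

omit [IsCocomm k H] in
lemma convDistrib_tmul_one_mul (f : WithConv (H →ₗ[k] k))
    (z : WithConv (H →ₗ[k] k) ⊗[k] WithConv (H →ₗ[k] k)) (x y : H) :
    convDistrib k H ((f ⊗ₜ[k] (1 : WithConv (H →ₗ[k] k))) * z) (x ⊗ₜ y) =
      ∑ i ∈ (ℛ k x).index, f.ofConv ((ℛ k x).left i) *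
        convDistrib k H z ((ℛ k x).right i ⊗ₜ y) := by
  induction z with
  | zero =>
    rw [convTensor_mul_zero]
    simp
  | add a b ha hb =>
    rw [convTensor_mul_add]
    simp only [mul_add, map_add, LinearMap.add_apply, ha, hb, Finset.sum_add_distrib]
  | tmul g h =>
    rw [Algebra.TensorProduct.tmul_mul_tmul, one_mul]
    simp only [convDistrib_tmul]
    rw [(ℛ k x).convMul_apply, Finset.sum_mul]
    simp only [mul_assoc]

lemma convDistrib_one_tmul_mul (f : WithConv (H →ₗ[k] k))
    (z : WithConv (H →ₗ[k] k) ⊗[k] WithConv (H →ₗ[k] k)) (x y : H) :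
    convDistrib k H (((1 : WithConv (H →ₗ[k] k)) ⊗ₜ[k] f) * z) (x ⊗ₜ y) =
      ∑ i ∈ (ℛ k y).index, convDistrib k H z (x ⊗ₜ (ℛ k y).left i) *
        f.ofConv ((ℛ k y).right i) := by
  induction z with
  | zero =>
    rw [convTensor_mul_zero]
    simp
  | add a b ha hb =>
    rw [convTensor_mul_add]
    simp only [add_mul, map_add, LinearMap.add_apply, ha, hb, Finset.sum_add_distrib]
  | tmul g h =>
    rw [Algebra.TensorProduct.tmul_mul_tmul, one_mul, mul_comm f h]
    simp only [convDistrib_tmul]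
    rw [(ℛ k y).convMul_apply, Finset.mul_sum]
    simp only [mul_assoc]

lemma lmul'_eq_convDistrib (z : WithConv (H →ₗ[k] k) ⊗[k] WithConv (H →ₗ[k] k)) (x : H) :
    (Algebra.TensorProduct.lmul' k z).ofConv x = convDistrib k H z (comul x) := by
  induction z with
  | zero => simp
  | add a b ha hb => simp only [map_add, LinearMap.add_apply, ha, hb, WithConv.ofConv_add]
  | tmul g h =>
    rw [Algebra.TensorProduct.lmul'_apply_tmul, (ℛ k x).convMul_apply]
    conv_rhs => rw [← (ℛ k x).eq]
    simp [convDistrib_tmul]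

/-- The form (x, y) ↦ λ(x S(y)), seen as an element of the tensor square of the dual, is a
separability idempotent: `slice_mul_antipode` is the commutation rule, and λ(1) = 1 says that it
multiplies to the counit. -/
lemma formallyUnramified_dual {lam : H →ₗ[k] k} (hlam : IsDualIntegral k lam) :
    Algebra.FormallyUnramified k (WithConv (H →ₗ[k] k)) := by
  have : Module.Finite k (WithConv (H →ₗ[k] k)) :=
    Module.Finite.equiv (WithConv.linearEquiv k (H →ₗ[k] k)).symm
  rw [Algebra.FormallyUnramified.iff_exists_tensorProduct]
  let τ : Module.Dual k (H ⊗[k] H) := lam ∘ₗ LinearMap.mul' k H ∘ₗ (antipode k).lTensor H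
  have hτ (x y : H) : τ (x ⊗ₜ y) = lam (x * antipode k y) := rfl
  refine ⟨(convDistrib k H).symm τ, fun f => ?_, ?_⟩
  · rw [sub_mul, sub_eq_zero]
    apply (convDistrib k H).injective
    ext x y
    simp only [TensorProduct.AlgebraTensorModule.curry_apply, TensorProduct.curry_apply,
      LinearMap.restrictScalars_self]
    rw [convDistrib_one_tmul_mul, convDistrib_tmul_one_mul]
    simp only [LinearEquiv.apply_symm_apply, hτ]
    have h := congrArg f.ofConv (hlam.slice_mul_antipode x y)
    simp only [map_sum, map_smul, smul_eq_mul] at h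
    rw [← h]
    exact Finset.sum_congr rfl fun i _ => mul_comm _ _
  · ext x
    rw [lmul'_eq_convDistrib, LinearEquiv.apply_symm_apply]
    change lam (LinearMap.mul' k H ((antipode k).lTensor H (comul x))) = _
    rw [mul_antipode_lTensor_comul_apply, Algebra.algebraMap_eq_smul_one, map_smul, hlam.one]
    simp

/-- By reflexivity `ψ` is evaluation at some `x`. Multiplicativity says that every functional on `H
⊗ H` kills Δ(x) - x ⊗ x. -/
lemma exists_groupLike_of_algHom (ψ : WithConv (H →ₗ[k] k) →ₐ[k] k) :
    ∃ g : GroupLike k H, ∀ f, ψ f = f.ofConv g.val := by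
  let ψ' : Module.Dual k (Module.Dual k H) :=
    ψ.toLinearMap ∘ₗ (WithConv.linearEquiv k (H →ₗ[k] k)).symm.toLinearMap
  let x : H := (Module.evalEquiv k H).symm ψ'
  have hx (f : WithConv (H →ₗ[k] k)) : ψ f = f.ofConv x := by
    have : ψ' f.ofConv = f.ofConv x :=
      (LinearMap.congr_fun ((Module.evalEquiv k H).apply_symm_apply ψ') f.ofConv).symm
    exact this
  refine ⟨⟨x, ?_, ?_⟩, hx⟩
  · have := hx 1
    rw [map_one] at this
    simpa using this.symm
  · rw [← sub_eq_zero]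
    refine (Module.forall_dual_apply_eq_zero_iff k _).1 fun φ => ?_
    obtain ⟨z, rfl⟩ := (convDistrib k H).surjective φ
    rw [map_sub, sub_eq_zero]
    induction z with
    | zero => simp
    | add a b ha hb => simp only [map_add, LinearMap.add_apply, ha, hb]
    | tmul f g =>
      rw [convDistrib_tmul, ← lmul'_eq_convDistrib, Algebra.TensorProduct.lmul'_apply_tmul,
        ← hx, ← hx, ← hx, map_mul]

/-- A form vanishing on all group-likes is killed by all characters of the dual algebra, which is
reduced, so the form is zero. -/
lemma span_groupLike [IsAlgClosed k] {lam : H →ₗ[k] k} (hlam : IsDualIntegral k lam) :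
    Submodule.span k (Set.range fun g : GroupLike k H => g.val) = ⊤ := by
  have : Module.Finite k (WithConv (H →ₗ[k] k)) :=
    Module.Finite.equiv (WithConv.linearEquiv k (H →ₗ[k] k)).symm
  have := formallyUnramified_dual hlam
  have hred : IsReduced (WithConv (H →ₗ[k] k)) :=
    Algebra.FormallyUnramified.isReduced_of_field k _
  by_contra hne
  obtain ⟨f, hf, hle⟩ := Submodule.exists_le_ker_of_lt_top _ (lt_top_iff_ne_top.2 hne)
  refine hf ?_
  have : toConv f = 0 := by
    refine eq_zero_of_forall_algHom_eq_zero (F := k) _ fun ψ => ?_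
    obtain ⟨g, hg⟩ := exists_groupLike_of_algHom ψ
    rw [hg]
    exact hle (Submodule.subset_span ⟨g, rfl⟩)
  exact congrArg WithConv.ofConv this

omit [IsCocomm k H] in
variable (k H) in
lemma finite_groupLike : Finite (GroupLike k H) :=
  (linearIndep_groupLikeVal (R := k) (A := H)).finite

-- The sum `ν` of the group-likes satisfies `ν x = ε(x) ν`, so `ν = ν Λ = ε(ν) Λ`, and ε(ν) is the
-- order of the group. If this were zero, so would be `ν`, against independence of group-likes.
omit [IsCocomm k H] [Module.Finite k H] in
lemma card_groupLike_ne_zero [Fintype (GroupLike k H)]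
    (hspan : Submodule.span k (Set.range fun g : GroupLike k H => g.val) = ⊤) {Λ : H}
    (hΛ : ∀ h, h * Λ = counit (R := k) h • Λ) (hΛ1 : counit (R := k) Λ = 1) :
    (Fintype.card (GroupLike k H) : k) ≠ 0 := by
  intro h0
  let ν : H := ∑ g : GroupLike k H, g.val
  have hν (g : GroupLike k H) : ν * g.val = ν := by
    rw [Finset.sum_mul]
    exact Fintype.sum_equiv (Equiv.mulRight g) _ _ fun _ => rfl
  have hνx (x : H) : ν * x = counit (R := k) x • ν := by
    have hx : x ∈ Submodule.span k (Set.range fun g : GroupLike k H => g.val) := by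
      rw [hspan]; trivial
    induction hx using Submodule.span_induction with
    | zero => simp
    | add x y _ _ hx hy => rw [mul_add, hx, hy, map_add, add_smul]
    | smul c x _ hx => rw [mul_smul_comm, hx, map_smul, smul_smul, smul_eq_mul]
    | mem x hx =>
      obtain ⟨g, rfl⟩ := hx
      simp [hν]
  have hν0 : ν = 0 := by
    have h1 := hνx Λ
    rw [hΛ1, one_smul, hΛ] at h1
    rw [← h1, map_sum]
    simp [h0]
  have := Fintype.linearIndependent_iff.1 (linearIndep_groupLikeVal (R := k) (A := H))
    (fun _ => 1) (by simpa [ν] using hν0) 1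
  exact one_ne_zero this

end DualAlgebra

/-! ### Extension of scalars for integrals and group-likes -/

section BaseChange

open Coalgebra

variable {k H F : Type*} [Field k] [Ring H] [HopfAlgebra k H] [Field F] [Algebra k F]

/-- Cosemisimplicity is carried to `F` by the integral, whose defining identities are linear, and
not by simple subcoalgebras, which may decompose. -/
lemma IsDualIntegral.baseChange {lam : H →ₗ[k] k} (hlam : IsDualIntegral k lam) :
    ∃ lam' : F ⊗[k] H →ₗ[F] F, IsDualIntegral F lam' := by
  let lam' : F ⊗[k] H →ₗ[F] F :=
    (TensorProduct.AlgebraTensorModule.rid k F F).toLinearMap ∘ₗ lam.baseChange F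
  have h' (c : F) (h : H) : lam' (c ⊗ₜ h) = lam h • c := by simp [lam']
  have hcomul (c : F) (h : H) : comul (R := F) (c ⊗ₜ[k] h) =
      ∑ i ∈ (ℛ k h).index, (c ⊗ₜ[k] (ℛ k h).left i) ⊗ₜ[F] ((1 : F) ⊗ₜ[k] (ℛ k h).right i) := by
    rw [TensorProduct.comul_tmul]
    conv_lhs => rw [← (ℛ k h).eq]
    simp only [TensorProduct.tmul_sum, map_sum, CommSemiring.comul_apply,
      TensorProduct.AlgebraTensorModule.tensorTensorTensorComm_tmul]
    refine Finset.sum_congr rfl fun i _ => ?_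
    have e (x : H) : c ⊗ₜ[k] x = c • ((1 : F) ⊗ₜ[k] x) := by simp [TensorProduct.smul_tmul']
    rw [e, e, TensorProduct.smul_tmul]
  refine ⟨lam', fun z => ?_, fun z => ?_, ?_⟩
  · induction z with
    | zero => simp
    | add a b ha hb => simp only [map_add, ha, hb, add_smul]
    | tmul c h =>
      have h1 := hlam.left h
      rw [← (ℛ k h).eq] at h1
      simp only [map_sum, LinearMap.lTensor_tmul, TensorProduct.rid_tmul] at h1
      rw [hcomul, h']
      simp only [map_sum, LinearMap.lTensor_tmul, TensorProduct.rid_tmul, h']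
      have h2 := congrArg (fun x => c ⊗ₜ[k] x) h1
      simp only [TensorProduct.tmul_sum] at h2
      simpa [TensorProduct.tmul_smul, TensorProduct.smul_tmul', Algebra.TensorProduct.one_def,
        mul_comm] using h2
  · induction z with
    | zero => simp
    | add a b ha hb => simp only [map_add, ha, hb, add_smul]
    | tmul c h =>
      have h1 := hlam.right h
      rw [← (ℛ k h).eq] at h1
      simp only [map_sum, LinearMap.rTensor_tmul, TensorProduct.lid_tmul] at h1
      rw [hcomul, h']
      simp only [map_sum, LinearMap.rTensor_tmul, TensorProduct.lid_tmul, h']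
      have h2 := congrArg (fun x => c ⊗ₜ[k] x) h1
      simp only [TensorProduct.tmul_sum] at h2
      simpa [TensorProduct.tmul_smul, TensorProduct.smul_tmul', Algebra.TensorProduct.one_def,
        mul_comm] using h2
  · rw [Algebra.TensorProduct.one_def, h', hlam.one, one_smul]

lemma left_integral_baseChange {Λ : H} (hΛ : ∀ h, h * Λ = counit (R := k) h • Λ)
    (x : F ⊗[k] H) :
    x * ((1 : F) ⊗ₜ[k] Λ) = counit (R := F) x • ((1 : F) ⊗ₜ[k] Λ) := by
  induction x with
  | zero => simp
  | add a b ha hb => simp only [add_mul, map_add, add_smul, ha, hb]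
  | tmul c h =>
    rw [Algebra.TensorProduct.tmul_mul_tmul, hΛ, TensorProduct.counit_tmul]
    simp [TensorProduct.tmul_smul, TensorProduct.smul_tmul']

variable (k H F) in
/-- The group-like elements of the base change of a semisimple cosemisimple cocommutative Hopf
algebra to an algebraically closed field. -/
theorem groupLike_baseChange [IsAlgClosed F] [IsSemisimpleRing H] [IsCocomm k H]
    (hH : IsCosemisimpleCoalgebra k H) :
    Submodule.span F (Set.range fun g : GroupLike F (F ⊗[k] H) => g.val) = ⊤ ∧
      ∃ _ : Fintype (GroupLike F (F ⊗[k] H)),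
        (Fintype.card (GroupLike F (F ⊗[k] H)) : F) ≠ 0 := by
  have := finite_of_isSemisimpleRing k H
  obtain ⟨lam, hlam⟩ := exists_isDualIntegral k H hH
  obtain ⟨lam', hlam'⟩ := hlam.baseChange (F := F)
  obtain ⟨Λ, hΛ, hΛ1⟩ := exists_left_integral k H
  have hspan := span_groupLike hlam'
  have := finite_groupLike F (F ⊗[k] H)
  have := Fintype.ofFinite (GroupLike F (F ⊗[k] H))
  refine ⟨hspan, this, card_groupLike_ne_zero hspan (left_integral_baseChange hΛ) ?_⟩
  rw [TensorProduct.counit_tmul, hΛ1, one_smul]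
  rfl

end BaseChange

/-! ### The universal property of the crossed product -/

namespace CrossedSystem

open Coalgebra

variable {k H R : Type*} [Field k] [Ring H] [HopfAlgebra k H] [Ring R] [Algebra k R]
  (D : CrossedSystem k H R)

/-- The embedding `R → R #_σ H` as an algebra map. -/
noncomputable def ofBaseAlgHom : R →ₐ[k] D.Product :=
  AlgHom.ofLinearMap
    { toFun := D.ofBase
      map_add' := map_add D.ofBase
      map_smul' := fun c r => (TensorProduct.smul_tmul' c r (1 : H)).symm }
    (map_one D.ofBase) (map_mul D.ofBase)

/-- The linear map `H → R #_σ H`, `h ↦ 1 # h`. -/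
noncomputable def ofHopf : H →ₗ[k] D.Product := (inr k R H).toLinearMap

lemma ofHopf_one : D.ofHopf 1 = 1 := rfl

lemma ofBase_mul (r : R) (x : R ⊗[k] H) :
    (D.ofBase r * (show D.Product from x) : D.Product) = (inl k R H r * x : R ⊗[k] H) := by
  change D.mulMap (r ⊗ₜ[k] (1 : H)) x = (r ⊗ₜ[k] (1 : H)) * x
  have := D.mulMap_left r 1 x
  rw [mul_one] at this
  rw [this, Algebra.TensorProduct.one_def, one_mulMap]

lemma ofBase_mul_ofHopf (r : R) (h : H) :
    D.ofBase r * D.ofHopf h = (show D.Product from r ⊗ₜ[k] h) := by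
  refine (D.ofBase_mul r (1 ⊗ₜ[k] h)).trans ?_
  change (r ⊗ₜ[k] (1 : H)) * (1 ⊗ₜ[k] h) = r ⊗ₜ[k] h
  rw [Algebra.TensorProduct.tmul_mul_tmul, mul_one, one_mul]

lemma induction_product {p : D.Product → Prop} (x : D.Product) (h0 : p 0)
    (hadd : ∀ x y, p x → p y → p (x + y)) (hmul : ∀ r h, p (D.ofBase r * D.ofHopf h)) : p x := by
  refine TensorProduct.induction_on (motive := p) x h0 (fun r h => ?_) hadd
  have := hmul r h
  rwa [ofBase_mul_ofHopf] at this

lemma ofHopf_mul_ofHopf_apply (h l : H) : D.ofHopf h * D.ofHopf l =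
    ∑ i ∈ (ℛ k (h ⊗ₜ[k] l)).index, D.ofBase (D.σ.val.ofConv ((ℛ k (h ⊗ₜ[k] l)).left i)) *
      D.ofHopf (LinearMap.mul' k H ((ℛ k (h ⊗ₜ[k] l)).right i)) := by
  have h1 : D.ofHopf h * D.ofHopf l = (show D.Product from D.twist 1 (h ⊗ₜ l)) := by
    refine (D.mulMap_tmul 1 1 h l).trans ?_
    exact one_mul _
  have h2 : toConv (D.actLeft 1) = 1 := by
    ext x y
    simp [actLeft, act_one, Algebra.algebraMap_eq_smul_one, smul_smul, mul_comm]
  rw [h1, twist_apply_eq_sum, h2, one_mul]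
  refine Finset.sum_congr rfl fun i _ => ?_
  rw [ofBase_mul_ofHopf]

lemma ofHopf_mul_ofHopf :
    toConv (TensorProduct.lift ((LinearMap.mul k D.Product).compl₁₂ D.ofHopf D.ofHopf)) =
      toConv (D.ofBaseAlgHom.toLinearMap ∘ₗ D.σ.val.ofConv) *
        toConv (D.ofHopf ∘ₗ LinearMap.mul' k H) := by
  ext h l
  simp only [TensorProduct.AlgebraTensorModule.curry_apply, TensorProduct.curry_apply,
    LinearMap.restrictScalars_self]
  rw [(ℛ k (h ⊗ₜ[k] l)).convMul_apply]
  exact D.ofHopf_mul_ofHopf_apply h l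

lemma ofHopf_mul_ofBase_apply (h : H) (r : R) : D.ofHopf h * D.ofBase r =
    ∑ i ∈ (ℛ k h).index, D.ofBase (D.act ((ℛ k h).left i) r) * D.ofHopf ((ℛ k h).right i) := by
  have h1 : D.ofHopf h * D.ofBase r = (show D.Product from D.twist r (h ⊗ₜ 1)) := by
    refine (D.mulMap_tmul 1 r h 1).trans ?_
    exact one_mul _
  have h2 (h : H) : (toConv ((inl k R H).toLinearMap ∘ₗ D.σ.val.ofConv) *
      toConv ((inr k R H).toLinearMap ∘ₗ LinearMap.mul' k H)).ofConv (h ⊗ₜ 1) = 1 ⊗ₜ h := by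
    rw [conv_tmul_one]
    conv_rhs => rw [← sum_counit_smul (ℛ k h)]
    simp [σ_one_right, TensorProduct.tmul_sum, Algebra.algebraMap_eq_smul_one,
      TensorProduct.smul_tmul', inr]
  rw [h1]
  change (toConv (D.twist r)).ofConv (h ⊗ₜ 1) = _
  rw [twist_eq, conv_tmul_one]
  refine Finset.sum_congr rfl fun i _ => ?_
  rw [h2, ofBase_mul_ofHopf]
  simp [inl, proj_tmul]

lemma ofHopf_mul_ofBase (r : R) :
    toConv (LinearMap.mulRight k (D.ofBase r) ∘ₗ D.ofHopf) =
      toConv (D.ofBaseAlgHom.toLinearMap ∘ₗ D.act.flip r) * toConv D.ofHopf := by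
  ext h
  rw [(ℛ k h).convMul_apply]
  exact D.ofHopf_mul_ofBase_apply h r

section Lift

variable {B : Type*} [Ring B] [Algebra k B]

lemma algHom_ext' {f g : D.Product →ₐ[k] B} (h1 : ∀ r, f (D.ofBase r) = g (D.ofBase r))
    (h2 : ∀ h, f (D.ofHopf h) = g (D.ofHopf h)) : f = g := by
  ext x
  induction x using induction_product with
  | h0 => simp
  | hadd x y hx hy => rw [map_add, map_add, hx, hy]
  | hmul r h => rw [map_mul, map_mul, h1, h2]

variable (f : R →ₐ[k] B) (J : H →ₗ[k] B)

/-- The linear map `R #_σ H → B`, `r # h ↦ f(r) J(h)`. -/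
noncomputable def liftLinear : D.Product →ₗ[k] B :=
  TensorProduct.lift ((LinearMap.mul k B).compl₁₂ f.toLinearMap J)

lemma liftLinear_apply (r : R) (h : H) :
    D.liftLinear f J (D.ofBase r * D.ofHopf h) = f r * J h := by
  rw [ofBase_mul_ofHopf]
  rfl

lemma liftLinear_ofBase_mul (r : R) (x : D.Product) :
    D.liftLinear f J (D.ofBase r * x) = f r * D.liftLinear f J x := by
  induction x using induction_product with
  | h0 => simp
  | hadd x y hx hy => rw [mul_add, map_add, map_add, hx, hy, mul_add]
  | hmul s h => rw [← mul_assoc, ← map_mul, liftLinear_apply, liftLinear_apply, map_mul, mul_assoc]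

/-- The universal property of the crossed product. -/
noncomputable def lift (h1 : J 1 = 1)
    (hb : ∀ r, toConv (LinearMap.mulRight k (f r) ∘ₗ J) =
      toConv (f.toLinearMap ∘ₗ D.act.flip r) * toConv J)
    (hc : toConv (TensorProduct.lift ((LinearMap.mul k B).compl₁₂ J J)) =
      toConv (f.toLinearMap ∘ₗ D.σ.val.ofConv) * toConv (J ∘ₗ LinearMap.mul' k H)) :
    D.Product →ₐ[k] B :=
  AlgHom.ofLinearMap (D.liftLinear f J)
    (by
      have := D.liftLinear_apply f J 1 1
      rwa [map_one D.ofBase, map_one f, h1, ofHopf_one, one_mul, mul_one] at this)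
    (fun x y => by
      have hJ (h : H) : D.liftLinear f J (D.ofHopf h) = J h := by
        have := D.liftLinear_apply f J 1 h
        rwa [map_one, map_one, one_mul, one_mul] at this
      have hbb (h : H) (r : R) : D.liftLinear f J (D.ofHopf h * D.ofBase r) = J h * f r := by
        have := congrArg (fun φ => φ.ofConv h) (hb r)
        rw [(ℛ k h).convMul_apply] at this
        rw [ofHopf_mul_ofBase_apply, map_sum]
        simp only [liftLinear_apply]
        exact this.symm
      have hcc (h l : H) : D.liftLinear f J (D.ofHopf h * D.ofHopf l) = J h * J l := by
        have := congrArg (fun φ => φ.ofConv (h ⊗ₜ[k] l)) hc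
        rw [(ℛ k (h ⊗ₜ[k] l)).convMul_apply] at this
        rw [ofHopf_mul_ofHopf_apply, map_sum]
        simp only [liftLinear_apply]
        exact this.symm
      -- General multiplicativity is reached by peeling factors off the right: first an element of
      -- `H` by `hcc`, then one of `R` by `hbb`.
      have hright (x : D.Product) (l : H) :
          D.liftLinear f J (x * D.ofHopf l) = D.liftLinear f J x * J l := by
        induction x using induction_product with
        | h0 => simp
        | hadd x y hx hy => rw [add_mul, map_add, map_add, hx, hy, add_mul]
        | hmul r h =>
          rw [mul_assoc, liftLinear_ofBase_mul, hcc, liftLinear_apply, mul_assoc]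
      induction y using induction_product with
      | h0 => simp
      | hadd y z hy hz => rw [mul_add, map_add, map_add, hy, hz, mul_add]
      | hmul s l =>
        rw [← mul_assoc, hright, liftLinear_apply, ← mul_assoc]
        congr 1
        induction x using induction_product with
        | h0 => simp
        | hadd x y hx hy => rw [add_mul, map_add, map_add, hx, hy, add_mul]
        | hmul r h =>
          rw [mul_assoc, liftLinear_ofBase_mul, hbb, liftLinear_apply, mul_assoc])

variable (h1 : J 1 = 1)
    (hb : ∀ r, toConv (LinearMap.mulRight k (f r) ∘ₗ J) =
      toConv (f.toLinearMap ∘ₗ D.act.flip r) * toConv J)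
    (hc : toConv (TensorProduct.lift ((LinearMap.mul k B).compl₁₂ J J)) =
      toConv (f.toLinearMap ∘ₗ D.σ.val.ofConv) * toConv (J ∘ₗ LinearMap.mul' k H))

lemma lift_ofHopf (h : H) : D.lift f J h1 hb hc (D.ofHopf h) = J h := by
  have := D.liftLinear_apply f J 1 h
  rwa [map_one, map_one, one_mul, one_mul] at this

lemma lift_ofBase (r : R) : D.lift f J h1 hb hc (D.ofBase r) = f r := by
  have := D.liftLinear_apply f J r 1
  rwa [h1, mul_one, ofHopf_one, mul_one] at this

end Lift

end CrossedSystem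

/-! ### The scalar extension as a free module over the extended base ring -/

namespace CrossedSystem

open Coalgebra

variable {k H R : Type*} [Field k] [Ring H] [HopfAlgebra k H] [Ring R] [Algebra k R]
  (D : CrossedSystem k H R) (F : Type*) [Field F] [Algebra k F]

/-- The base change `F ⊗ R → F ⊗ (R #_σ H)` of the embedding. -/
noncomputable def baseEmb : F ⊗[k] R →ₐ[F] F ⊗[k] D.Product :=
  Algebra.TensorProduct.map (AlgHom.id F F) D.ofBaseAlgHom

lemma baseEmb_tmul (c : F) (r : R) : D.baseEmb F (c ⊗ₜ r) = c ⊗ₜ D.ofBase r := rfl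

/-- `F ⊗ (R #_σ H)` as a left module over `F ⊗ R`. -/
@[reducible] noncomputable def baseModule : Module (F ⊗[k] R) (F ⊗[k] D.Product) :=
  Module.compHom _ (D.baseEmb F).toRingHom

attribute [local instance] baseModule

lemma base_smul_def (s : F ⊗[k] R) (x : F ⊗[k] D.Product) : s • x = D.baseEmb F s * x := rfl

lemma base_smul_one (s : F ⊗[k] R) : s • (1 : F ⊗[k] D.Product) = D.baseEmb F s := mul_one _

lemma base_isScalarTower : IsScalarTower (F ⊗[k] R) (F ⊗[k] D.Product) (F ⊗[k] D.Product) :=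
  ⟨fun s x y => mul_assoc (D.baseEmb F s) x y⟩

lemma induction_baseChange {p : F ⊗[k] D.Product → Prop} (x : F ⊗[k] D.Product) (h0 : p 0)
    (hadd : ∀ x y, p x → p y → p (x + y))
    (hmul : ∀ (s : F ⊗[k] R) h, p (D.baseEmb F s * 1 ⊗ₜ D.ofHopf h)) : p x := by
  induction x with
  | zero => exact h0
  | add x y hx hy => exact hadd x y hx hy
  | tmul c x =>
    induction x using induction_product with
    | h0 => rwa [TensorProduct.tmul_zero]
    | hadd x y hx hy => rw [TensorProduct.tmul_add]; exact hadd _ _ hx hy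
    | hmul r h =>
      have := hmul (c ⊗ₜ r) h
      rwa [baseEmb_tmul, Algebra.TensorProduct.tmul_mul_tmul, mul_one] at this

/-- The coordinates of `R #_σ H = R ⊗ H`. -/
noncomputable def coord (η : H →ₗ[k] k) : D.Product →ₗ[k] R :=
  TensorProduct.rid k R ∘ₗ (η.lTensor R : R ⊗[k] H →ₗ[k] R ⊗[k] k)

lemma coord_ofBase_mul_ofHopf (η : H →ₗ[k] k) (r : R) (h : H) :
    D.coord η (D.ofBase r * D.ofHopf h) = η h • r := by
  rw [ofBase_mul_ofHopf]
  change TensorProduct.rid k R (η.lTensor R (r ⊗ₜ[k] h)) = _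
  rw [LinearMap.lTensor_tmul, TensorProduct.rid_tmul]

/-- Left multiplication by `F ⊗ R` does not touch the tensor factor `H`. The second clause says that
elements coming from `R #_σ H` have coordinates coming from `R`, which descent needs. -/
lemma exists_basis {ι : Type*} (b : Module.Basis ι k H) :
    ∃ e : Module.Basis ι (F ⊗[k] R) (F ⊗[k] D.Product),
      ∀ x i, e.repr (1 ⊗ₜ x) i = 1 ⊗ₜ D.coord (b.coord i) x := by
  classical
  let E : F ⊗[k] D.Product ≃ₗ[k] ι →₀ F ⊗[k] R :=
    (TensorProduct.assoc k F R H).symm ≪≫ₗ TensorProduct.equivFinsuppOfBasisRight b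
  have hE (c : F) (r : R) (h : H) (i : ι) :
      E (c ⊗ₜ (D.ofBase r * D.ofHopf h)) i = b.repr h i • (c ⊗ₜ[k] r) := by
    rw [ofBase_mul_ofHopf]
    refine (congrArg (fun z => TensorProduct.equivFinsuppOfBasisRight b z i)
      (TensorProduct.assoc_symm_tmul c r h)).trans ?_
    simp
  have hsmul (s : F ⊗[k] R) (x : F ⊗[k] D.Product) : E (s • x) = s • E x := by
    induction x using D.induction_baseChange F with
    | h0 => rw [smul_zero, map_zero, smul_zero]
    | hadd x y hx hy => rw [smul_add, map_add, map_add, hx, hy, smul_add]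
    | hmul t h =>
      rw [base_smul_def, ← mul_assoc, ← map_mul]
      have key (t : F ⊗[k] R) (i : ι) :
          E (D.baseEmb F t * 1 ⊗ₜ D.ofHopf h) i = b.repr h i • t := by
        induction t with
        | zero => simp
        | add x y hx hy => rw [map_add, add_mul, map_add, Finsupp.add_apply, hx, hy, smul_add]
        | tmul c r =>
          rw [baseEmb_tmul, Algebra.TensorProduct.tmul_mul_tmul, mul_one, hE]
      ext i
      rw [key, Finsupp.smul_apply, key, smul_eq_mul, mul_smul_comm]
  refine ⟨Module.Basis.ofRepr { E with map_smul' := hsmul }, fun x i => ?_⟩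
  change E (1 ⊗ₜ x) i = _
  induction x using induction_product with
  | h0 => simp
  | hadd x y hx hy =>
    rw [TensorProduct.tmul_add, map_add, Finsupp.add_apply, hx, hy, map_add, TensorProduct.tmul_add]
  | hmul r h =>
    rw [hE, coord_ofBase_mul_ofHopf, TensorProduct.tmul_smul]
    rfl

lemma coord_counit_ofBase (r : R) : D.coord counit (D.ofBase r) = r := by
  have := D.coord_ofBase_mul_ofHopf counit r 1
  rwa [ofHopf_one, mul_one, Bialgebra.counit_one, one_smul] at this

lemma baseEmb_injective : Function.Injective (D.baseEmb F) := by
  refine Function.LeftInverse.injective (g := (D.coord counit).lTensor F) fun s => ?_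
  induction s with
  | zero => simp
  | add x y hx hy => rw [map_add, map_add, hx, hy]
  | tmul c r => rw [baseEmb_tmul, LinearMap.lTensor_tmul, coord_counit_ofBase]

lemma smash_induction {I : Ideal R} {p : D.Product → Prop} {x : D.Product} (hx : x ∈ D.smash I)
    (h0 : p 0) (hadd : ∀ x y, p x → p y → p (x + y))
    (hmul : ∀ r ∈ I, ∀ h, p (D.ofBase r * D.ofHopf h)) : p x := by
  obtain ⟨y, rfl⟩ := hx
  induction y with
  | zero => exact (congrArg p (map_zero
      (LinearMap.rTensor H (I.restrictScalars k).subtype : _ →ₗ[k] R ⊗[k] H))).mpr h0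
  | add y z hy hz =>
    exact (congrArg p (map_add (LinearMap.rTensor H (I.restrictScalars k).subtype :
      _ →ₗ[k] R ⊗[k] H) y z)).mpr (hadd _ _ hy hz)
  | tmul r h =>
    have := hmul r.1 r.2 h
    rwa [ofBase_mul_ofHopf] at this

end CrossedSystem

/-! ### Descent of the radical from `F` to `k` -/

section Descent

variable {k A F : Type*} [Field k] [Ring A] [Algebra k A] [Field F] [Algebra k F]

/-- The base change hypotheses enter the argument in this form; the factors are swapped so that `F`
acts from the left. -/
lemma JacobsonCommutesWithBaseChange.mem_iff (h : JacobsonCommutesWithBaseChange k A F) (x : A) :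
    x ∈ Ring.jacobson A ↔ (1 : F) ⊗ₜ[k] x ∈ Ring.jacobson (F ⊗[k] A) := by
  have h1 : (1 : F) ⊗ₜ[k] x ∈ Ring.jacobson (F ⊗[k] A) ↔
      x ⊗ₜ[k] (1 : F) ∈ Ring.jacobson (A ⊗[k] F) := by
    let e := (Algebra.TensorProduct.comm k F A).toRingEquiv
    have : RingHomSurjective e.toRingHom := ⟨e.surjective⟩
    have : RingHomSurjective e.symm.toRingHom := ⟨e.symm.surjective⟩
    exact ⟨fun hx => Ring.le_comap_jacobson e.toRingHom hx,
      fun hx => Ring.le_comap_jacobson e.symm.toRingHom hx⟩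
  have h2 : x ⊗ₜ[k] (1 : F) ∈ Ring.jacobson (A ⊗[k] F) ↔ x ⊗ₜ[k] (1 : F) ∈
      LinearMap.range (LinearMap.rTensor F ((Ring.jacobson A).restrictScalars k).subtype) := by
    rw [← h]; rfl
  rw [h1, h2]
  constructor
  · exact fun hx => ⟨⟨x, hx⟩ ⊗ₜ 1, rfl⟩
  · rintro ⟨y, hy⟩
    -- Slicing by a form on `F` with value one at `1` recovers `x` and maps the extended radical
    -- back into the radical.
    obtain ⟨π, hπ⟩ := Module.Projective.exists_dual_eq_one k (one_ne_zero : (1 : F) ≠ 0)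
    have hx : x = TensorProduct.rid k A (π.lTensor A (x ⊗ₜ 1)) := by simp [hπ]
    rw [hx, ← hy]
    clear hx hy
    induction y with
    | zero => simp
    | add y z hy hz => simp only [map_add]; exact Ideal.add_mem _ hy hz
    | tmul r c => simpa using ((Ring.jacobson A).restrictScalars k).smul_mem (π c) r.2

end Descent

namespace CrossedSystem

open Coalgebra

variable {k H R : Type*} [Field k] [Ring H] [HopfAlgebra k H] [Ring R] [Algebra k R]
  (D : CrossedSystem k H R) (F : Type*) [Field F] [Algebra k F]

attribute [local instance] baseModule

/-- Both cases end here: `h₁` and `h₂` descend to `k`, so all slices of the radical of the crossed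
product lie in that of `R`, and the latter radical lies in the former. -/
theorem jacobson_eq_smash {ι : Type*} [Finite ι] {b : Module.Basis ι k H}
    {e : Module.Basis ι (F ⊗[k] R) (F ⊗[k] D.Product)}
    (he : ∀ x i, e.repr (1 ⊗ₜ x) i = 1 ⊗ₜ D.coord (b.coord i) x)
    (h₁ : ∀ x ∈ Ring.jacobson (F ⊗[k] D.Product), ∀ i, e.repr x i ∈ Ring.jacobson (F ⊗[k] R))
    (h₂ : ∀ s ∈ Ring.jacobson (F ⊗[k] R), s • (1 : F ⊗[k] D.Product) ∈
      Ring.jacobson (F ⊗[k] D.Product))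
    (hR : JacobsonCommutesWithBaseChange k R F)
    (hA : JacobsonCommutesWithBaseChange k D.Product F) :
    (Ring.jacobson R = D.jacobsonH ∧ D.jacobsonH = D.jacobsonCore) ∧
      (Ring.jacobson D.Product).restrictScalars k = D.smash D.jacobsonH := by
  have := Fintype.ofFinite ι
  have hbase (r : R) (hr : r ∈ Ring.jacobson R) : D.ofBase r ∈ Ring.jacobson D.Product := by
    rw [hA.mem_iff]
    have := h₂ _ ((hR.mem_iff r).1 hr)
    rwa [base_smul_one] at this
  have hcoord (x : D.Product) (hx : x ∈ Ring.jacobson D.Product) (η : H →ₗ[k] k) :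
      D.coord η x ∈ Ring.jacobson R := by
    have hi (i : ι) : D.coord (b.coord i) x ∈ Ring.jacobson R := by
      rw [hR.mem_iff, ← he]
      exact h₁ _ ((hA.mem_iff x).1 hx) i
    have h3 : D.coord η x = ∑ i, η (b i) • D.coord (b.coord i) x := by
      clear hx hi
      induction x using induction_product with
      | h0 => simp
      | hadd x y hx hy => simp only [map_add, smul_add, Finset.sum_add_distrib, hx, hy]
      | hmul r h =>
        simp only [coord_ofBase_mul_ofHopf, smul_smul, ← Finset.sum_smul]
        congr 1
        conv_lhs => rw [← b.sum_repr h]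
        simp only [map_sum, map_smul, smul_eq_mul, Module.Basis.coord_apply, mul_comm]
    rw [h3]
    exact ((Ring.jacobson R).restrictScalars k).sum_mem fun i _ =>
      ((Ring.jacobson R).restrictScalars k).smul_mem _ (hi i)
  have hsmash : (Ring.jacobson D.Product).restrictScalars k = D.smash (Ring.jacobson R) := by
    refine le_antisymm (fun x hx => ?_) ?_
    · exact mem_range_rTensor_of_forall_slice _ (x : R ⊗[k] H) (hcoord x hx)
    · intro x hx
      exact D.smash_induction (p := fun x => x ∈ Ring.jacobson D.Product) hx (zero_mem _)
        (fun _ _ => add_mem)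
        fun r hr h => (Ring.jacobson D.Product).mul_mem_right (D.ofHopf h) (hbase r hr)
  have hH : D.jacobsonH = Ring.jacobson R := by
    ext r
    refine ⟨fun hr => ?_, hbase r⟩
    have := hcoord _ hr counit
    rwa [coord_counit_ofBase] at this
  have hC : D.jacobsonCore = Ring.jacobson R := by
    ext r
    refine ⟨fun hr => ?_, fun hr h => ?_⟩
    · have := hr 1
      rwa [one_act] at this
    -- The element `h · r` is the counit slice of (1 # h)(r # 1) = ∑ (h₁ · r) # h₂.
    · have := hcoord _ ((Ring.jacobson D.Product).mul_mem_left (D.ofHopf h) (hbase r hr)) counit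
      rw [ofHopf_mul_ofBase_apply, map_sum] at this
      simp only [coord_ofBase_mul_ofHopf] at this
      have h3 : D.act h r = ∑ i ∈ (ℛ k h).index,
          counit (R := k) ((ℛ k h).right i) • D.act ((ℛ k h).left i) r := by
        have := sum_tmul_counit_eq (ℛ k h)
        have := congrArg (fun z => D.act (TensorProduct.rid k H z) r) this
        simp only [map_sum, TensorProduct.rid_tmul, map_smul, LinearMap.sum_apply,
          LinearMap.smul_apply, one_smul] at this
        exact this.symm
      rwa [h3]
  rw [hH, hC]
  exact ⟨⟨rfl, rfl⟩, hsmash⟩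

end CrossedSystem

/-! ### Convolution with commuting factors -/

section Convolution

open Coalgebra

variable {k C E B : Type*} [Field k] [AddCommGroup C] [Module k C] [Coalgebra k C]
  [AddCommGroup E] [Module k E] [Coalgebra k E] [Ring B] [Algebra k B]

lemma conv_assoc (f g h : WithConv (C →ₗ[k] B)) : f * g * h = f * (g * h) := mul_assoc f g h

lemma conv_one_mul (f : WithConv (C →ₗ[k] B)) : 1 * f = f := one_mul f

lemma conv_mul_one (f : WithConv (C →ₗ[k] B)) : f * 1 = f := mul_one f

lemma mulRight_comp_conv {x : B} (f : WithConv (C →ₗ[k] B)) {χ : WithConv (C →ₗ[k] B)}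
    (h : ∀ c, Commute (χ.ofConv c) x) :
    toConv (LinearMap.mulRight k x ∘ₗ (f * χ).ofConv) =
      toConv (LinearMap.mulRight k x ∘ₗ f.ofConv) * χ := by
  ext c
  rw [(ℛ k c).convMul_apply]
  change (f * χ).ofConv c * x = _
  rw [(ℛ k c).convMul_apply, Finset.sum_mul]
  refine Finset.sum_congr rfl fun i _ => ?_
  change _ = f.ofConv _ * x * χ.ofConv _
  rw [mul_assoc, mul_assoc, (h _).eq]

lemma lift_mul_conv (f : WithConv (C →ₗ[k] B)) {χ : WithConv (C →ₗ[k] B)}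
    {g : WithConv (E →ₗ[k] B)} (ψ : WithConv (E →ₗ[k] B))
    (h : ∀ c e, Commute (χ.ofConv c) (g.ofConv e)) :
    toConv (TensorProduct.lift ((LinearMap.mul k B).compl₁₂ (f * χ).ofConv (g * ψ).ofConv)) =
      toConv (TensorProduct.lift ((LinearMap.mul k B).compl₁₂ f.ofConv g.ofConv)) *
        toConv (TensorProduct.lift ((LinearMap.mul k B).compl₁₂ χ.ofConv ψ.ofConv)) := by
  ext c e
  simp only [TensorProduct.AlgebraTensorModule.curry_apply, TensorProduct.curry_apply,
    LinearMap.restrictScalars_self]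
  rw [CrossedSystem.conv_tmul]
  change (f * χ).ofConv c * (g * ψ).ofConv e = _
  rw [(ℛ k c).convMul_apply, (ℛ k e).convMul_apply, Finset.sum_mul_sum]
  refine Finset.sum_congr rfl fun i _ => Finset.sum_congr rfl fun j _ => ?_
  change _ = f.ofConv _ * g.ofConv _ * (χ.ofConv _ * ψ.ofConv _)
  rw [mul_assoc, mul_assoc, ← mul_assoc (χ.ofConv _), (h _ _).eq, mul_assoc]

end Convolution

/-! ### Commutative case: the Galois action of the character group -/

namespace CrossedSystem

open Coalgebra

section BaseChange

variable {k H R : Type*} [Field k] [Ring H] [HopfAlgebra k H] [Ring R] [Algebra k R]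
  (D : CrossedSystem k H R) (F : Type*) [Field F] [Algebra k F]

/-- The embedding `R → F ⊗ (R #_σ H)`. -/
noncomputable def baseF : R →ₐ[k] F ⊗[k] D.Product :=
  (Algebra.TensorProduct.includeRight : D.Product →ₐ[k] F ⊗[k] D.Product).comp D.ofBaseAlgHom

/-- The linear map `H → F ⊗ (R #_σ H)`. -/
noncomputable def hopfF : H →ₗ[k] F ⊗[k] D.Product :=
  (Algebra.TensorProduct.includeRight : D.Product →ₐ[k] F ⊗[k] D.Product).toLinearMap ∘ₗ D.ofHopf

variable {F} in
/-- A linear functional on `H`, with values in the centre of `F ⊗ (R #_σ H)`. -/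
noncomputable def scalarF (χ : H →ₗ[k] F) : H →ₗ[k] F ⊗[k] D.Product :=
  (Algebra.ofId F (F ⊗[k] D.Product)).toLinearMap.restrictScalars k ∘ₗ χ

lemma baseF_apply (r : R) : D.baseF F r = 1 ⊗ₜ D.ofBase r := rfl

lemma hopfF_apply (h : H) : D.hopfF F h = 1 ⊗ₜ D.ofHopf h := rfl

variable {F} in
lemma scalarF_apply (χ : H →ₗ[k] F) (h : H) :
    D.scalarF χ h = algebraMap F (F ⊗[k] D.Product) (χ h) := rfl

variable {F} in
lemma scalarF_commute (χ : H →ₗ[k] F) (h : H) (x : F ⊗[k] D.Product) :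
    Commute (D.scalarF χ h) x := Algebra.commutes (χ h) x

lemma hopfF_mul_baseF (r : R) :
    toConv (LinearMap.mulRight k (D.baseF F r) ∘ₗ D.hopfF F) =
      toConv ((D.baseF F).toLinearMap ∘ₗ D.act.flip r) * toConv (D.hopfF F) := by
  have := congrArg (fun φ => toConv ((Algebra.TensorProduct.includeRight :
    D.Product →ₐ[k] F ⊗[k] D.Product).toLinearMap ∘ₗ φ.ofConv)) (D.ofHopf_mul_ofBase r)
  rw [comp_conv] at this
  refine Eq.trans ?_ this
  ext h
  exact (map_mul (Algebra.TensorProduct.includeRight :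
    D.Product →ₐ[k] F ⊗[k] D.Product) _ _).symm

lemma hopfF_mul_hopfF :
    toConv (TensorProduct.lift ((LinearMap.mul k _).compl₁₂ (D.hopfF F) (D.hopfF F))) =
      toConv ((D.baseF F).toLinearMap ∘ₗ D.σ.val.ofConv) *
        toConv (D.hopfF F ∘ₗ LinearMap.mul' k H) := by
  have := congrArg (fun φ => toConv ((Algebra.TensorProduct.includeRight :
    D.Product →ₐ[k] F ⊗[k] D.Product).toLinearMap ∘ₗ φ.ofConv)) D.ofHopf_mul_ofHopf
  rw [comp_conv] at this
  refine Eq.trans ?_ this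
  ext h l
  exact (map_mul (Algebra.TensorProduct.includeRight :
    D.Product →ₐ[k] F ⊗[k] D.Product) _ _).symm

lemma algHomF_ext {B : Type*} [Ring B] [Algebra F B] {f g : F ⊗[k] D.Product →ₐ[F] B}
    (h1 : ∀ r, f (D.baseF F r) = g (D.baseF F r)) (h2 : ∀ h, f (D.hopfF F h) = g (D.hopfF F h)) :
    f = g := by
  let := Algebra.compHom B (algebraMap k F)
  have : IsScalarTower k F B := IsScalarTower.of_algebraMap_eq fun _ => rfl
  exact Algebra.TensorProduct.ext (Subsingleton.elim _ _) (D.algHom_ext' h1 h2)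

end BaseChange

section Character

variable {k H R : Type*} [Field k] [CommRing H] [HopfAlgebra k H] [Ring R] [Algebra k R]
  (D : CrossedSystem k H R) {F : Type*} [Field F] [Algebra k F]

attribute [local instance] characterGroup baseModule

/-- The map `h ↦ ∑ χ(h₂) ⊗ (1 # h₁)`. -/
noncomputable def charHopf (χ : WithConv (H →ₐ[k] F)) : H →ₗ[k] F ⊗[k] D.Product :=
  (toConv (D.hopfF F) * toConv (D.scalarF χ.ofConv.toLinearMap)).ofConv

lemma charHopf_apply (χ : WithConv (H →ₐ[k] F)) (h : H) : D.charHopf χ h =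
    ∑ i ∈ (ℛ k h).index, D.hopfF F ((ℛ k h).left i) *
      algebraMap F _ (χ.ofConv ((ℛ k h).right i)) :=
  (ℛ k h).convMul_apply (toConv (D.hopfF F)) (toConv (D.scalarF χ.ofConv.toLinearMap))

lemma charHopf_one (χ : WithConv (H →ₐ[k] F)) : D.charHopf χ 1 = 1 := by
  change LinearMap.mul' k _ (TensorProduct.map (D.hopfF F)
    (D.scalarF χ.ofConv.toLinearMap) (comul 1)) = 1
  rw [Bialgebra.comul_one, Algebra.TensorProduct.one_def, TensorProduct.map_tmul,
    LinearMap.mul'_apply, hopfF_apply, scalarF_apply, ofHopf_one, AlgHom.toLinearMap_apply,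
    map_one, map_one, mul_one]
  rfl

lemma charHopf_mul_baseF (χ : WithConv (H →ₐ[k] F)) (r : R) :
    toConv (LinearMap.mulRight k (D.baseF F r) ∘ₗ D.charHopf χ) =
      toConv ((D.baseF F).toLinearMap ∘ₗ D.act.flip r) * toConv (D.charHopf χ) := by
  have := mulRight_comp_conv (x := D.baseF F r) (toConv (D.hopfF F))
    (χ := toConv (D.scalarF χ.ofConv.toLinearMap)) fun c => D.scalarF_commute _ c _
  refine this.trans ?_
  rw [ofConv_toConv, hopfF_mul_baseF, conv_assoc]
  rfl

/-- The scalar factors are central, so the relation for `hopfF` passes through, and multiplicativity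
of `χ` reassembles them. -/
lemma charHopf_mul_charHopf (χ : WithConv (H →ₐ[k] F)) :
    toConv (TensorProduct.lift ((LinearMap.mul k _).compl₁₂ (D.charHopf χ) (D.charHopf χ))) =
      toConv ((D.baseF F).toLinearMap ∘ₗ D.σ.val.ofConv) *
        toConv (D.charHopf χ ∘ₗ LinearMap.mul' k H) := by
  have := lift_mul_conv (toConv (D.hopfF F)) (χ := toConv (D.scalarF χ.ofConv.toLinearMap))
    (g := toConv (D.hopfF F)) (toConv (D.scalarF χ.ofConv.toLinearMap))
    fun c e => D.scalarF_commute _ c _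
  refine this.trans ?_
  rw [ofConv_toConv, hopfF_mul_hopfF, conv_assoc]
  congr 1
  refine Eq.trans ?_ (conv_comp (Bialgebra.mulCoalgHom k H) (toConv (D.hopfF F))
    (toConv (D.scalarF χ.ofConv.toLinearMap))).symm
  congr 1
  ext h l
  simp [scalarF_apply]

/-- The restriction to `R #_σ H` of the action of a character of `H`. -/
noncomputable def charLift (χ : WithConv (H →ₐ[k] F)) : D.Product →ₐ[k] F ⊗[k] D.Product :=
  D.lift (D.baseF F) (D.charHopf χ) (D.charHopf_one χ) (D.charHopf_mul_baseF χ)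
    (D.charHopf_mul_charHopf χ)

/-- The action of a character of `H` on `F ⊗ (R #_σ H)`, `r # h ↦ ∑ χ(h₂) r # h₁`. -/
noncomputable def charAct (χ : WithConv (H →ₐ[k] F)) :
    F ⊗[k] D.Product →ₐ[F] F ⊗[k] D.Product :=
  Algebra.TensorProduct.lift (Algebra.ofId F _) (D.charLift χ) fun c x =>
    show Commute _ _ from Algebra.commutes c (D.charLift χ x)

lemma charAct_one_tmul (χ : WithConv (H →ₐ[k] F)) (x : D.Product) :
    D.charAct χ (1 ⊗ₜ x) = D.charLift χ x := by
  rw [charAct, Algebra.TensorProduct.lift_tmul, map_one, one_mul]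

lemma charAct_baseF (χ : WithConv (H →ₐ[k] F)) (r : R) :
    D.charAct χ (D.baseF F r) = D.baseF F r :=
  (D.charAct_one_tmul χ _).trans (D.lift_ofBase ..)

lemma charAct_hopfF (χ : WithConv (H →ₐ[k] F)) (h : H) :
    D.charAct χ (D.hopfF F h) = D.charHopf χ h :=
  (D.charAct_one_tmul χ _).trans (D.lift_ofHopf ..)

lemma charAct_smul_one (χ : WithConv (H →ₐ[k] F)) (s : F ⊗[k] R) :
    D.charAct χ (s • (1 : F ⊗[k] D.Product)) = s • (1 : F ⊗[k] D.Product) := by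
  rw [base_smul_one]
  induction s with
  | zero => simp
  | add x y hx hy => rw [map_add, map_add, hx, hy]
  | tmul c r =>
    have : D.baseEmb F (c ⊗ₜ r) = c • D.baseF F r := by
      rw [baseEmb_tmul, baseF_apply, TensorProduct.smul_tmul', smul_eq_mul, mul_one]
    rw [this, map_smul, charAct_baseF]

variable (F) in
lemma charAct_one : D.charAct (1 : WithConv (H →ₐ[k] F)) = AlgHom.id F _ := by
  refine D.algHomF_ext F (fun r => charAct_baseF ..) fun h => ?_
  rw [charAct_hopfF, charHopf]
  have : toConv (D.scalarF (ofConv (1 : WithConv (H →ₐ[k] F))).toLinearMap) = 1 := by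
    ext h
    simp [scalarF_apply]
  rw [this, conv_mul_one]
  rfl

lemma charAct_mul (χ ψ : WithConv (H →ₐ[k] F)) :
    D.charAct (χ * ψ) = (D.charAct χ).comp (D.charAct ψ) := by
  refine D.algHomF_ext F (fun r => ?_) fun h => ?_
  · rw [AlgHom.comp_apply, charAct_baseF, charAct_baseF, charAct_baseF]
  · rw [AlgHom.comp_apply, charAct_hopfF, charAct_hopfF]
    have h1 := comp_conv ((D.charAct χ).restrictScalars k) (toConv (D.hopfF F))
      (toConv (D.scalarF ψ.ofConv.toLinearMap))
    have h2 : toConv (((D.charAct χ).restrictScalars k).toLinearMap ∘ₗ D.hopfF F) =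
        toConv (D.hopfF F) * toConv (D.scalarF χ.ofConv.toLinearMap) := by
      ext h
      exact D.charAct_hopfF χ h
    have h3 : toConv (((D.charAct χ).restrictScalars k).toLinearMap ∘ₗ
        D.scalarF ψ.ofConv.toLinearMap) = toConv (D.scalarF ψ.ofConv.toLinearMap) := by
      ext h
      exact (D.charAct χ).commutes _
    have h4 : toConv (D.scalarF (χ * ψ).ofConv.toLinearMap) =
        toConv (D.scalarF χ.ofConv.toLinearMap) * toConv (D.scalarF ψ.ofConv.toLinearMap) := by
      have := comp_conv (IsScalarTower.toAlgHom k F (F ⊗[k] D.Product))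
        (toConv χ.ofConv.toLinearMap) (toConv ψ.ofConv.toLinearMap)
      rw [← AlgHom.toLinearMap_convMul] at this
      exact this
    rw [h2, h3, conv_assoc, ← h4] at h1
    exact congrArg (fun φ => φ.ofConv h) h1.symm

/-- The action of the character group of `H` on `F ⊗ (R #_σ H)`. -/
noncomputable def charActHom (F : Type*) [Field F] [Algebra k F] :
    WithConv (H →ₐ[k] F) →* (F ⊗[k] D.Product →+* F ⊗[k] D.Product) where
  toFun χ := (D.charAct χ).toRingHom
  map_one' := by rw [charAct_one]; rfl
  map_mul' χ ψ := by rw [charAct_mul]; rfl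

lemma charAct_smul (χ : WithConv (H →ₐ[k] F)) (s : F ⊗[k] R) (x : F ⊗[k] D.Product) :
    D.charAct χ (s • x) = s • D.charAct χ x := by
  have := D.charAct_smul_one χ s
  rw [base_smul_one] at this
  rw [base_smul_def, base_smul_def, map_mul, this]

/-- Summing the characters turns χ(h₂) into a multiple of λ(h₂), and ∑ λ(h₂) h₁ = λ(h) 1. This is
what puts the trace into the base ring. -/
lemma sum_charHopf [IsAlgClosed F] [IsSemisimpleRing H] [Fintype (WithConv (H →ₐ[k] F))]
    {lam : H →ₗ[k] k} (hlam : IsDualIntegral k lam) (h : H) :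
    ∑ χ : WithConv (H →ₐ[k] F), D.charHopf χ h =
      (Fintype.card (WithConv (H →ₐ[k] F)) : F) • lam h • (1 : F ⊗[k] D.Product) := by
  have h1 := hlam.left h
  rw [← (ℛ k h).eq] at h1
  simp only [map_sum, LinearMap.lTensor_tmul, TensorProduct.rid_tmul] at h1
  have h2 := congrArg (D.hopfF F) h1
  simp only [map_sum, map_smul] at h2
  have h3 : D.hopfF F 1 = 1 := rfl
  rw [← h3, ← h2, Finset.smul_sum]
  simp only [charHopf_apply]
  rw [Finset.sum_comm]
  refine Finset.sum_congr rfl fun i _ => ?_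
  have h4 (n : F) (a : k) (x : F ⊗[k] D.Product) :
      n • a • x = algebraMap F _ n * (algebraMap k _ a * x) :=
    (Algebra.smul_def n _).trans (congrArg _ (Algebra.smul_def a x))
  rw [← Finset.mul_sum, ← map_sum, (sum_characters hlam).2, mul_comm, map_mul,
    ← IsScalarTower.algebraMap_apply, h4, ← mul_assoc, ← Algebra.commutes, ← Algebra.commutes]

lemma sum_charAct_mem [IsAlgClosed F] [IsSemisimpleRing H] [Fintype (WithConv (H →ₐ[k] F))]
    {lam : H →ₗ[k] k} (hlam : IsDualIntegral k lam) (x : F ⊗[k] D.Product) :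
    ∃ t : F ⊗[k] R, ∑ χ, D.charAct χ x = t • (1 : F ⊗[k] D.Product) := by
  induction x using D.induction_baseChange F with
  | h0 => exact ⟨0, by simp⟩
  | hadd x y hx hy =>
    obtain ⟨s, hs⟩ := hx
    obtain ⟨t, ht⟩ := hy
    exact ⟨s + t, by simp only [map_add, Finset.sum_add_distrib, hs, ht, add_smul]⟩
  | hmul s h =>
    refine ⟨(Fintype.card (WithConv (H →ₐ[k] F)) : F) • lam h • s, ?_⟩
    have (χ : WithConv (H →ₐ[k] F)) : D.charAct χ (D.baseEmb F s * 1 ⊗ₜ D.ofHopf h) =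
        s • D.charHopf χ h := by
      rw [← charAct_hopfF, ← charAct_smul]
      rfl
    simp only [this]
    rw [← Finset.smul_sum, sum_charHopf _ hlam]
    rw [base_smul_def, base_smul_one, map_smul, mul_smul_comm]
    congr 1
    rw [mul_smul_comm, mul_one]
    exact (map_smul ((D.baseEmb F).restrictScalars k) (lam h) s).symm

/-- `x ⊗ y ↦ x χ(y)`. -/
noncomputable def mulChar (χ : WithConv (H →ₐ[k] F)) :
    (F ⊗[k] D.Product) ⊗[k] (F ⊗[k] D.Product) →ₗ[k] F ⊗[k] D.Product :=
  LinearMap.mul' k _ ∘ₗ ((D.charAct χ).toLinearMap.restrictScalars k).lTensor _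

lemma mulChar_tmul (χ : WithConv (H →ₐ[k] F)) (x y : F ⊗[k] D.Product) :
    D.mulChar χ (x ⊗ₜ y) = x * D.charAct χ y := rfl

lemma mulChar_mulLeft (χ : WithConv (H →ₐ[k] F)) (b : F ⊗[k] D.Product)
    (T : (F ⊗[k] D.Product) ⊗[k] (F ⊗[k] D.Product)) :
    D.mulChar χ ((LinearMap.mulLeft k b).rTensor _ T) = b * D.mulChar χ T := by
  induction T with
  | zero => rw [map_zero, map_zero, mul_zero]
  | add x y hx hy => rw [map_add, map_add, map_add, mul_add, hx, hy]
  | tmul x y => rw [LinearMap.rTensor_tmul, mulChar_tmul, mulChar_tmul, LinearMap.mulLeft_apply,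
      mul_assoc]

lemma mulChar_map_hopfF (χ : WithConv (H →ₐ[k] F)) (w : H ⊗[k] H) :
    D.mulChar χ (TensorProduct.map (D.hopfF F) (D.hopfF F) w) =
      TensorProduct.lift ((LinearMap.mul k _).compl₁₂ (D.hopfF F) (D.charHopf χ)) w := by
  induction w with
  | zero => simp
  | add x y hx hy => simp only [map_add, hx, hy]
  | tmul x y =>
    rw [TensorProduct.map_tmul, mulChar_tmul, charAct_hopfF]
    rfl

lemma hopfF_mul_charHopf (χ : WithConv (H →ₐ[k] F)) :
    toConv (TensorProduct.lift ((LinearMap.mul k _).compl₁₂ (D.hopfF F) (D.charHopf χ))) =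
      toConv ((D.baseF F).toLinearMap ∘ₗ D.σ.val.ofConv) *
        (toConv (D.hopfF F ∘ₗ LinearMap.mul' k H) *
          toConv (TensorProduct.lift ((LinearMap.mul k _).compl₁₂
            (1 : WithConv (H →ₗ[k] F ⊗[k] D.Product)).ofConv
              (D.scalarF χ.ofConv.toLinearMap)))) := by
  have := lift_mul_conv (toConv (D.hopfF F)) (χ := (1 : WithConv (H →ₗ[k] F ⊗[k] D.Product)))
    (g := toConv (D.hopfF F)) (toConv (D.scalarF χ.ofConv.toLinearMap))
    fun c e => Algebra.commutes (counit (R := k) c) _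
  rw [conv_mul_one, ofConv_toConv, hopfF_mul_hopfF, conv_assoc] at this
  exact this

lemma hopfF_mul_char_apply (χ : WithConv (H →ₐ[k] F)) (l h : H) :
    (toConv (D.hopfF F ∘ₗ LinearMap.mul' k H) *
      toConv (TensorProduct.lift ((LinearMap.mul k _).compl₁₂
        (1 : WithConv (H →ₗ[k] F ⊗[k] D.Product)).ofConv
          (D.scalarF χ.ofConv.toLinearMap)))).ofConv (l ⊗ₜ h) =
      ∑ i ∈ (ℛ k h).index, D.hopfF F (l * (ℛ k h).left i) *
        D.scalarF χ.ofConv.toLinearMap ((ℛ k h).right i) := by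
  rw [conv_tmul, Finset.sum_comm]
  refine Finset.sum_congr rfl fun j _ => ?_
  have := sum_tmul_counit_eq (ℛ k l)
  have := congrArg (TensorProduct.rid k H) this
  simp only [map_sum, TensorProduct.rid_tmul, one_smul] at this
  conv_rhs => rw [← this, Finset.sum_mul, map_sum, Finset.sum_mul]
  refine Finset.sum_congr rfl fun i _ => ?_
  change D.hopfF F (_ * _) * (algebraMap k _ (counit (R := k) ((ℛ k l).right i)) *
    D.scalarF χ.ofConv.toLinearMap _) = _
  rw [smul_mul_assoc, map_smul, ← Algebra.smul_def, mul_smul_comm, smul_mul_assoc]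

/-- On S(h₁) ⊗ h₂ the map gives ∑ (1 # S(h₁) h₂) χ(h₃), which collapses to χ(h). -/
lemma hopfF_mul_char_antipode (χ : WithConv (H →ₐ[k] F)) (h : H) :
    (toConv (D.hopfF F ∘ₗ LinearMap.mul' k H) *
      toConv (TensorProduct.lift ((LinearMap.mul k _).compl₁₂
        (1 : WithConv (H →ₗ[k] F ⊗[k] D.Product)).ofConv
          (D.scalarF χ.ofConv.toLinearMap)))).ofConv
      ((HopfAlgebra.antipode k).rTensor H (comul h)) = D.scalarF χ.ofConv.toLinearMap h := by
  set V := (toConv (D.hopfF F ∘ₗ LinearMap.mul' k H) *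
      toConv (TensorProduct.lift ((LinearMap.mul k _).compl₁₂
        (1 : WithConv (H →ₗ[k] F ⊗[k] D.Product)).ofConv
          (D.scalarF χ.ofConv.toLinearMap)))).ofConv with hV
  let M : (H ⊗[k] H) ⊗[k] H →ₗ[k] F ⊗[k] D.Product :=
    TensorProduct.lift ((LinearMap.mul k _).compl₁₂
      (D.hopfF F ∘ₗ LinearMap.mul' k H ∘ₗ (HopfAlgebra.antipode k).rTensor H)
      (D.scalarF χ.ofConv.toLinearMap))
  have h1 : V ∘ₗ (HopfAlgebra.antipode k).rTensor H =
      M ∘ₗ (TensorProduct.assoc k H H H).symm.toLinearMap ∘ₗ (comul (R := k)).lTensor H := by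
    ext x y
    simp only [TensorProduct.AlgebraTensorModule.curry_apply, TensorProduct.curry_apply,
      LinearMap.restrictScalars_self, LinearMap.comp_apply, LinearMap.rTensor_tmul,
      LinearMap.lTensor_tmul]
    rw [hV, hopfF_mul_char_apply]
    conv_rhs => rw [← (ℛ k y).eq]
    simp only [TensorProduct.tmul_sum, map_sum]
    rfl
  have h2 := LinearMap.congr_fun h1 (comul h)
  refine h2.trans ?_
  simp only [LinearMap.comp_apply, LinearEquiv.coe_coe]
  rw [coassoc_symm_apply, ← (ℛ k h).eq]
  simp only [map_sum, LinearMap.rTensor_tmul]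
  have h3 (a b : H) : M (comul a ⊗ₜ b) = D.scalarF χ.ofConv.toLinearMap (counit (R := k) a • b) := by
    change D.hopfF F (LinearMap.mul' k H ((HopfAlgebra.antipode k).rTensor H (comul a))) *
      D.scalarF χ.ofConv.toLinearMap b = _
    rw [HopfAlgebra.mul_antipode_rTensor_comul_apply, map_smul, Algebra.algebraMap_eq_smul_one,
      map_smul, smul_mul_assoc]
    congr 1
    exact one_mul _
  simp only [h3]
  rw [← map_sum, sum_counit_smul]

/-- This is the Hopf–Galois property. For `z = ∑ S(h₁) ⊗ h₂`, weighting the product of the two legs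
by `σ⁻¹` cancels the cocycle. It is essential that `T` does not depend on `χ`. -/
lemma exists_mulChar_eq_scalarF (h : H) :
    ∃ T, ∀ χ : WithConv (H →ₐ[k] F), D.mulChar χ T = D.scalarF χ.ofConv.toLinearMap h := by
  set z := (HopfAlgebra.antipode k).rTensor H (comul (R := k) h) with hz
  let σ' : WithConv (H ⊗[k] H →ₗ[k] F ⊗[k] D.Product) :=
    toConv ((D.baseF F).toLinearMap ∘ₗ (D.σ⁻¹).val.ofConv)
  refine ⟨∑ i ∈ (ℛ k z).index, (LinearMap.mulLeft k (σ'.ofConv ((ℛ k z).left i))).rTensor _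
    (TensorProduct.map (D.hopfF F) (D.hopfF F) ((ℛ k z).right i)), fun χ => ?_⟩
  rw [← hopfF_mul_char_antipode, ← hz, map_sum]
  simp only [mulChar_mulLeft, mulChar_map_hopfF]
  have h1 := D.hopfF_mul_charHopf χ
  have h2 : σ' * toConv ((D.baseF F).toLinearMap ∘ₗ D.σ.val.ofConv) = 1 := by
    have := comp_conv (D.baseF F) (D.σ⁻¹).val D.σ.val
    rw [Units.inv_mul] at this
    refine this.symm.trans ?_
    ext x y
    exact (D.baseF F).commutes _
  have h3 := congrArg (fun φ => (σ' * φ).ofConv z) h1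
  simp only [← conv_assoc σ', h2, conv_one_mul] at h3
  rw [← h3, (ℛ k z).convMul_apply]

lemma exists_mulChar_eq (x : F ⊗[k] H) :
    ∃ T, ∀ χ : WithConv (H →ₐ[k] F), D.mulChar χ T = algebraMap F _
      (LinearMap.liftBaseChange F χ.ofConv.toLinearMap x) := by
  induction x with
  | zero => exact ⟨0, fun χ => by simp⟩
  | add x y hx hy =>
    obtain ⟨S, hS⟩ := hx
    obtain ⟨T, hT⟩ := hy
    exact ⟨S + T, fun χ => by simp only [map_add, hS, hT]⟩
  | tmul c h =>
    obtain ⟨T, hT⟩ := D.exists_mulChar_eq_scalarF (F := F) h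
    refine ⟨(LinearMap.mulLeft k (algebraMap F _ c)).rTensor _ T, fun χ => ?_⟩
    rw [mulChar_mulLeft, hT, scalarF_apply, ← map_mul]
    simp

-- Independence of the characters gives `v` in `F ⊗ H` on which the trivial character is `1` and all
-- others are `0`; the tensor `T` attached to `v` supplies the pairs.
open Classical in
lemma exists_galois_elements [Fintype (WithConv (H →ₐ[k] F))] :
    ∃ (X : Finset ((F ⊗[k] D.Product) × (F ⊗[k] D.Product))),
      ∀ χ : WithConv (H →ₐ[k] F), ∑ i ∈ X, i.1 * D.charAct χ i.2 = if χ = 1 then 1 else 0 := by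
  have hli : LinearIndependent F fun χ : WithConv (H →ₐ[k] F) =>
      LinearMap.liftBaseChange F χ.ofConv.toLinearMap := by
    have h := (linearIndependent_algHom_toLinearMap k H F).comp
      (WithConv.ofConv : WithConv (H →ₐ[k] F) → _) WithConv.ofConv_injective
    exact h.map' (LinearMap.liftBaseChangeEquiv F).toLinearMap (LinearEquiv.ker _)
  obtain ⟨v, hv⟩ := exists_apply_eq_ite hli 1
  obtain ⟨T, hT⟩ := D.exists_mulChar_eq v
  obtain ⟨X, rfl⟩ := TensorProduct.exists_finset T
  refine ⟨X, fun χ => ?_⟩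
  have := hT χ
  rw [hv, map_sum] at this
  refine this.trans ?_
  split_ifs
  · exact map_one _
  · exact map_zero _

end Character

section Commutative

attribute [local instance] characterGroup baseModule

/-- The description of the Jacobson radical of a crossed product with a commutative semisimple
cosemisimple Hopf algebra. -/
theorem jacobson_eq_smash_of_commRing {k H R F : Type*} [Field k] [CommRing H] [HopfAlgebra k H]
    [Ring R] [Algebra k R] (D : CrossedSystem k H R) [Field F] [Algebra k F] [IsAlgClosed F]
    [IsSemisimpleRing H] (hcoss : IsCosemisimpleCoalgebra k H)
    (hR : JacobsonCommutesWithBaseChange k R F)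
    (hA : JacobsonCommutesWithBaseChange k D.Product F) :
    (Ring.jacobson R = D.jacobsonH ∧ D.jacobsonH = D.jacobsonCore) ∧
      (Ring.jacobson D.Product).restrictScalars k = D.smash D.jacobsonH := by
  classical
  have := finite_of_isSemisimpleRing k H
  have := finite_characters k H F
  have := Fintype.ofFinite (WithConv (H →ₐ[k] F))
  have := D.base_isScalarTower F
  obtain ⟨lam, hlam⟩ := exists_isDualIntegral k H hcoss
  obtain ⟨e, he⟩ := D.exists_basis F (Module.finBasis k H)
  obtain ⟨X, hX⟩ := D.exists_galois_elements (F := F)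
  have hcard : IsUnit (Fintype.card (WithConv (H →ₐ[k] F)) : F ⊗[k] D.Product) := by
    have := (sum_characters (F := F) hlam).1.isUnit.map (algebraMap F (F ⊗[k] D.Product))
    rwa [map_natCast] at this
  obtain ⟨h₁, h₂⟩ := jacobson_of_galois (D.charActHom F) (fun χ s => D.charAct_smul_one χ s)
    (fun x => D.sum_charAct_mem hlam x) X Prod.fst Prod.snd
    (fun χ => (hX χ).trans (by congr)) e hcard
  exact D.jacobson_eq_smash F he h₁ h₂ hR hA

end Commutative

end CrossedSystem

/-! ### Convolution products evaluated at group-like elements -/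

section GroupLikeEvaluation

open Coalgebra

variable {k C E A F : Type*} [Field k] [AddCommGroup C] [Module k C] [Coalgebra k C]
  [AddCommGroup E] [Module k E] [Coalgebra k E] [Ring A] [Algebra k A] [Field F] [Algebra k F]

lemma comul_one_tmul (c : C) : comul (R := F) ((1 : F) ⊗ₜ[k] c) =
    ∑ i ∈ (ℛ k c).index, ((1 : F) ⊗ₜ[k] (ℛ k c).left i) ⊗ₜ[F] ((1 : F) ⊗ₜ[k] (ℛ k c).right i) := by
  rw [TensorProduct.comul_tmul]
  conv_lhs => rw [← (ℛ k c).eq]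
  simp only [TensorProduct.tmul_sum, map_sum, CommSemiring.comul_apply,
    TensorProduct.AlgebraTensorModule.tensorTensorTensorComm_tmul]

/-- At a group-like point convolution becomes ordinary multiplication; thereby Hopf-theoretic
identities turn into relations between units. -/
lemma baseChange_conv (φ ψ : WithConv (C →ₗ[k] A)) {p : F ⊗[k] C}
    (hp : comul (R := F) p = p ⊗ₜ p) :
    (φ * ψ).ofConv.baseChange F p = φ.ofConv.baseChange F p * ψ.ofConv.baseChange F p := by
  have h : (φ * ψ).ofConv.baseChange F = LinearMap.mul' F (F ⊗[k] A) ∘ₗ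
      TensorProduct.map (φ.ofConv.baseChange F) (ψ.ofConv.baseChange F) ∘ₗ comul := by
    ext c
    simp only [TensorProduct.AlgebraTensorModule.curry_apply, TensorProduct.curry_apply,
      LinearMap.comp_apply, LinearMap.coe_restrictScalars]
    rw [comul_one_tmul, LinearMap.baseChange_tmul, (ℛ k c).convMul_apply]
    simp [TensorProduct.tmul_sum]
  rw [h, LinearMap.comp_apply, LinearMap.comp_apply, hp, TensorProduct.map_tmul,
    LinearMap.mul'_apply]

/-- `(c ⊗ x, d ⊗ y) ↦ c d ⊗ (x ⊗ y)`. -/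
noncomputable def basePair : F ⊗[k] C →ₗ[F] F ⊗[k] E →ₗ[F] F ⊗[k] (C ⊗[k] E) :=
  TensorProduct.curry
    (TensorProduct.AlgebraTensorModule.distribBaseChange k F C E).symm.toLinearMap

omit [Coalgebra k C] [Coalgebra k E] in
lemma basePair_tmul (c d : F) (x : C) (y : E) :
    basePair (c ⊗ₜ[k] x) (d ⊗ₜ[k] y) = (c * d) ⊗ₜ[k] (x ⊗ₜ[k] y) := by
  simp [basePair]

lemma baseChange_conv_basePair (φ ψ : WithConv (C ⊗[k] E →ₗ[k] A)) {p : F ⊗[k] C} {q : F ⊗[k] E}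
    (hp : comul (R := F) p = p ⊗ₜ p) (hq : comul (R := F) q = q ⊗ₜ q) :
    (φ * ψ).ofConv.baseChange F (basePair p q) =
      φ.ofConv.baseChange F (basePair p q) * ψ.ofConv.baseChange F (basePair p q) := by
  let Φ := (TensorProduct.map₂ (basePair.compr₂ (φ.ofConv.baseChange F))
    (basePair.compr₂ (ψ.ofConv.baseChange F))).compr₂ (LinearMap.mul' F (F ⊗[k] A))
  have h : basePair.compr₂ ((φ * ψ).ofConv.baseChange F) = Φ.compl₁₂ comul comul := by
    ext x y
    simp only [TensorProduct.AlgebraTensorModule.curry_apply, TensorProduct.curry_apply,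
      LinearMap.coe_restrictScalars, LinearMap.compr₂_apply, LinearMap.compl₁₂_apply]
    rw [basePair_tmul, LinearMap.baseChange_tmul, CrossedSystem.conv_tmul, comul_one_tmul,
      comul_one_tmul]
    simp only [Φ, map_sum, LinearMap.sum_apply, LinearMap.compr₂_apply,
      TensorProduct.map₂_apply_tmul, TensorProduct.tmul_sum, basePair_tmul, LinearMap.baseChange_tmul, LinearMap.mul'_apply,
      TensorProduct.map_tmul, Algebra.TensorProduct.tmul_mul_tmul, mul_one]
    exact Finset.sum_comm
  refine (LinearMap.congr_fun₂ h p q).trans ?_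
  rw [LinearMap.compl₁₂_apply, hp, hq]
  simp [Φ]

lemma baseChange_one_basePair {p : F ⊗[k] C} {q : F ⊗[k] E}
    (hp : counit (R := F) p = 1) (hq : counit (R := F) q = 1) :
    (1 : WithConv (C ⊗[k] E →ₗ[k] A)).ofConv.baseChange F (basePair p q) = 1 := by
  have h : basePair.compr₂ ((1 : WithConv (C ⊗[k] E →ₗ[k] A)).ofConv.baseChange F) =
      (LinearMap.mul F (F ⊗[k] A)).compl₁₂ (Algebra.linearMap F _ ∘ₗ counit)
        (Algebra.linearMap F _ ∘ₗ counit) := by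
    ext x y
    simp [basePair_tmul, mul_comm, Algebra.algebraMap_eq_smul_one, TensorProduct.tmul_smul,
      smul_smul, Algebra.TensorProduct.one_def]
  refine (LinearMap.congr_fun₂ h p q).trans ?_
  rw [LinearMap.compl₁₂_apply, LinearMap.comp_apply, LinearMap.comp_apply, hp, hq,
    Algebra.linearMap_apply, map_one]
  exact one_mul _

end GroupLikeEvaluation

lemma isUnit_of_isUnit_mul {B : Type*} [Monoid B] {x y : B} (h1 : IsUnit (x * y))
    (h2 : IsUnit (y * x)) : IsUnit x := by
  obtain ⟨a, ha⟩ := h1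
  obtain ⟨b, hb⟩ := h2
  have h3 : x * (y * ↑a⁻¹) = 1 := by rw [← mul_assoc, ← ha, Units.mul_inv]
  have h4 : ↑b⁻¹ * y * x = 1 := by rw [mul_assoc, ← hb, Units.inv_mul]
  exact ⟨⟨x, y * ↑a⁻¹, h3, by rwa [← left_inv_eq_right_inv h4 h3]⟩, rfl⟩

/-- A unit that normalizes the image of an injective ring homomorphism acts on its source by
automorphisms. -/
lemma exists_ringEquiv_of_conj {S B : Type*} [Ring S] [Ring B] {ι : S →+* B}
    (hι : Function.Injective ι) (u : Bˣ) (h1 : ∀ s, ∃ t, u * ι s = ι t * u)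
    (h2 : ∀ t, ∃ s, u * ι s = ι t * u) : ∃ α : S ≃+* S, ∀ s, u * ι s = ι (α s) * u := by
  choose α hα using h1
  have hinj {s t : S} (h : ι s * (u : B) = ι t * u) : s = t := hι (u.isUnit.mul_left_injective h)
  let f : S →+* S :=
    { toFun := α
      map_one' := hinj (by rw [← hα, map_one, mul_one, one_mul])
      map_mul' := fun s t => hinj (by
        rw [← hα, map_mul, ← mul_assoc, hα, mul_assoc, hα, map_mul, mul_assoc])
      map_zero' := hinj (by rw [← hα, map_zero, mul_zero, zero_mul])
      map_add' := fun s t => hinj (by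
        rw [← hα, map_add, mul_add, hα, hα, map_add, add_mul]) }
  refine ⟨RingEquiv.ofBijective f ⟨fun s t h => ?_, fun t => ?_⟩, hα⟩
  · have h3 : (u : B) * ι s = u * ι t := by
      rw [hα, hα]
      exact congrArg (fun z => ι z * (u : B)) h
    exact hι (u.isUnit.mul_right_injective h3)
  · obtain ⟨s, hs⟩ := h2 t
    exact ⟨s, hinj (by rw [← hs]; exact (hα s).symm)⟩

/-! ### Cocommutative case: a crossed product with the group of group-likes -/

namespace CrossedSystem

open Coalgebra

variable {k H R : Type*} [Field k] [Ring H] [HopfAlgebra k H] [Ring R] [Algebra k R]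
  (D : CrossedSystem k H R) {F : Type*} [Field F] [Algebra k F]

attribute [local instance] baseModule

/-- The linear map `F ⊗ H → F ⊗ (R #_σ H)`. -/
noncomputable def hopfBase (F : Type*) [Field F] [Algebra k F] :
    F ⊗[k] H →ₗ[F] F ⊗[k] D.Product := D.ofHopf.baseChange F

lemma hopfBase_tmul (c : F) (h : H) : D.hopfBase F (c ⊗ₜ h) = c ⊗ₜ D.ofHopf h := rfl

lemma hopfBase_one : D.hopfBase F 1 = 1 := rfl

lemma baseEmb_baseChange {C : Type*} [AddCommGroup C] [Module k C] (φ : C →ₗ[k] R)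
    (x : F ⊗[k] C) : (D.ofBaseAlgHom.toLinearMap ∘ₗ φ).baseChange F x =
      D.baseEmb F (φ.baseChange F x) := by
  induction x with
  | zero => simp
  | add x y hx hy => simp only [map_add, hx, hy]
  | tmul c x => rfl

/-- At a group-like the relation (1 # h)(r # 1) = ∑ (h₁ · r) # h₂ reads `g r = (g · r) g`. -/
lemma exists_hopfBase_mul_baseEmb (g : GroupLike F (F ⊗[k] H)) (s : F ⊗[k] R) :
    ∃ t, D.hopfBase F g.val * D.baseEmb F s = D.baseEmb F t * D.hopfBase F g.val := by
  induction s with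
  | zero => exact ⟨0, by simp⟩
  | add x y hx hy =>
    obtain ⟨s, hs⟩ := hx
    obtain ⟨t, ht⟩ := hy
    exact ⟨s + t, by rw [map_add, map_add, mul_add, add_mul, hs, ht]⟩
  | tmul c r =>
    have h1 := congrArg (fun φ => φ.ofConv.baseChange F g.val) (D.ofHopf_mul_ofBase r)
    have h2 := h1.trans (baseChange_conv _ _ g.isGroupLikeElem_val.comul_eq_tmul_self)
    have h3 (x : F ⊗[k] H) : (LinearMap.mulRight k (D.ofBase r) ∘ₗ D.ofHopf).baseChange F x =
        D.hopfBase F x * 1 ⊗ₜ D.ofBase r := by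
      induction x with
      | zero => simp
      | add x y hx hy => rw [map_add, map_add, add_mul, hx, hy]
      | tmul d h => rw [hopfBase_tmul, Algebra.TensorProduct.tmul_mul_tmul, mul_one]; rfl
    refine ⟨c • (D.act.flip r).baseChange F g.val, ?_⟩
    have h4 : D.baseEmb F (c ⊗ₜ r) = c • (1 : F) ⊗ₜ[k] D.ofBase r := by
      rw [baseEmb_tmul, TensorProduct.smul_tmul', smul_eq_mul, mul_one]
    rw [h4, mul_smul_comm, map_smul, smul_mul_assoc, ← baseEmb_baseChange]
    congr 1
    exact (h3 g.val).symm.trans h2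

/-- The value of `σ` on a pair of group-like elements, as a unit. -/
noncomputable def cocycleUnit (g h : GroupLike F (F ⊗[k] H)) : (F ⊗[k] R)ˣ where
  val := D.σ.val.ofConv.baseChange F (basePair g.val h.val)
  inv := (D.σ⁻¹).val.ofConv.baseChange F (basePair g.val h.val)
  val_inv := by
    rw [← baseChange_conv_basePair _ _ g.isGroupLikeElem_val.comul_eq_tmul_self
      h.isGroupLikeElem_val.comul_eq_tmul_self, Units.mul_inv]
    exact baseChange_one_basePair g.isGroupLikeElem_val.counit_eq_one
      h.isGroupLikeElem_val.counit_eq_one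
  inv_val := by
    rw [← baseChange_conv_basePair _ _ g.isGroupLikeElem_val.comul_eq_tmul_self
      h.isGroupLikeElem_val.comul_eq_tmul_self, Units.inv_mul]
    exact baseChange_one_basePair g.isGroupLikeElem_val.counit_eq_one
      h.isGroupLikeElem_val.counit_eq_one

lemma hopfBase_mul_hopfBase (g h : GroupLike F (F ⊗[k] H)) :
    D.hopfBase F g.val * D.hopfBase F h.val =
      D.baseEmb F (D.cocycleUnit g h) * D.hopfBase F (g * h).val := by
  have h1 := congrArg (fun φ => φ.ofConv.baseChange F (basePair g.val h.val)) D.ofHopf_mul_ofHopf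
  have h2 := h1.trans (baseChange_conv_basePair _ _ g.isGroupLikeElem_val.comul_eq_tmul_self
    h.isGroupLikeElem_val.comul_eq_tmul_self)
  have h3 (x y : F ⊗[k] H) : (TensorProduct.lift ((LinearMap.mul k D.Product).compl₁₂
      D.ofHopf D.ofHopf)).baseChange F (basePair x y) = D.hopfBase F x * D.hopfBase F y := by
    induction x with
    | zero => simp
    | add x z hx hz => simp only [map_add, LinearMap.add_apply, add_mul, hx, hz]
    | tmul c x =>
      induction y with
      | zero => simp
      | add y z hy hz => simp only [map_add, mul_add, hy, hz]
      | tmul d y =>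
        rw [basePair_tmul, hopfBase_tmul, hopfBase_tmul, Algebra.TensorProduct.tmul_mul_tmul]
        rfl
  have h4 (x y : F ⊗[k] H) : (D.ofHopf ∘ₗ LinearMap.mul' k H).baseChange F (basePair x y) =
      D.hopfBase F (x * y) := by
    induction x with
    | zero => simp
    | add x z hx hz => simp only [map_add, LinearMap.add_apply, add_mul, hx, hz]
    | tmul c x =>
      induction y with
      | zero => simp
      | add y z hy hz => simp only [map_add, mul_add, hy, hz]
      | tmul d y =>
        rw [basePair_tmul, Algebra.TensorProduct.tmul_mul_tmul]
        rfl
  have h5 := (h3 _ _).symm.trans h2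
  rw [ofConv_toConv, ofConv_toConv, h4, baseEmb_baseChange] at h5
  exact h5

lemma isUnit_baseEmb_cocycleUnit (g h : GroupLike F (F ⊗[k] H)) :
    IsUnit (D.baseEmb F (D.cocycleUnit g h)) :=
  (D.cocycleUnit g h).isUnit.map (D.baseEmb F)

lemma hopfBase_mul_inv (g : GroupLike F (F ⊗[k] H)) :
    D.hopfBase F g.val * D.hopfBase F (g⁻¹).val = D.baseEmb F (D.cocycleUnit g g⁻¹) := by
  rw [hopfBase_mul_hopfBase, mul_inv_cancel, GroupLike.val_one, hopfBase_one, mul_one]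

lemma isUnit_hopfBase (g : GroupLike F (F ⊗[k] H)) : IsUnit (D.hopfBase F g.val) := by
  refine isUnit_of_isUnit_mul (y := D.hopfBase F (g⁻¹).val) ?_ ?_
  · rw [hopfBase_mul_inv]
    exact D.isUnit_baseEmb_cocycleUnit _ _
  · have := D.hopfBase_mul_inv g⁻¹
    rw [inv_inv] at this
    rw [this]
    exact D.isUnit_baseEmb_cocycleUnit _ _

/-- The units of `F ⊗ (R #_σ H)` defined by group-like elements. -/
noncomputable def groupLikeUnit (g : GroupLike F (F ⊗[k] H)) : (F ⊗[k] D.Product)ˣ :=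
  (D.isUnit_hopfBase g).unit

lemma isCrossedGroupFamily_groupLikeUnit
    (hspan : Submodule.span F (Set.range fun g : GroupLike F (F ⊗[k] H) => g.val) = ⊤) :
    IsCrossedGroupFamily (F ⊗[k] R)
      (D.groupLikeUnit : GroupLike F (F ⊗[k] H) → (F ⊗[k] D.Product)ˣ) where
  conj g := by
    obtain ⟨α, hα⟩ := exists_ringEquiv_of_conj (ι := (D.baseEmb F).toRingHom)
      (D.baseEmb_injective F) (D.groupLikeUnit g) (D.exists_hopfBase_mul_baseEmb g) fun t => by
        have hi := D.hopfBase_mul_inv g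
        have hi' := D.hopfBase_mul_inv g⁻¹
        rw [inv_inv] at hi'
        -- The preimage of `t` is found by conjugating with `g⁻¹`. The factor `c(g, g⁻¹)⁻¹` before
        -- and `c(g⁻¹, g)` after correct for the product of the two units not being `1`.
        obtain ⟨s, hs⟩ := D.exists_hopfBase_mul_baseEmb g⁻¹
          (↑(D.cocycleUnit g g⁻¹)⁻¹ * t)
        refine ⟨s * D.cocycleUnit g⁻¹ g, ?_⟩
        change D.hopfBase F g.val * D.baseEmb F _ = D.baseEmb F t * D.hopfBase F g.val
        rw [map_mul, ← mul_assoc, ← hi', ← mul_assoc, mul_assoc _ (D.baseEmb F s), ← hs, map_mul,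
          ← mul_assoc, ← mul_assoc, hi, ← map_mul, Units.mul_inv, map_one, one_mul]
    exact ⟨α, fun s => by rw [base_smul_one]; exact hα s⟩
  mul g h := ⟨D.cocycleUnit g h, D.hopfBase_mul_hopfBase g h⟩
  span := by
    rw [eq_top_iff]
    rintro x -
    have hg (y : F ⊗[k] H) : D.hopfBase F y ∈ Submodule.span (F ⊗[k] R)
        (Set.range fun g : GroupLike F (F ⊗[k] H) => (D.groupLikeUnit g : F ⊗[k] D.Product)) := by
      have hy : y ∈ Submodule.span F (Set.range fun g : GroupLike F (F ⊗[k] H) => g.val) := by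
        rw [hspan]; trivial
      induction hy using Submodule.span_induction with
      | zero => rw [map_zero]; exact zero_mem _
      | add x y _ _ hx hy => rw [map_add]; exact add_mem hx hy
      | smul c x _ hx =>
        have : D.hopfBase F (c • x) = (algebraMap F (F ⊗[k] R) c) • D.hopfBase F x := by
          rw [base_smul_def, AlgHom.commutes, map_smul]
          exact Algebra.smul_def c (D.hopfBase F x)
        rw [this]
        exact Submodule.smul_mem _ _ hx
      | mem x hx =>
        obtain ⟨g, rfl⟩ := hx
        exact Submodule.subset_span ⟨g, rfl⟩
    induction x using D.induction_baseChange F with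
    | h0 => exact zero_mem _
    | hadd x y hx hy => exact add_mem hx hy
    | hmul s h => exact Submodule.smul_mem _ s (hg (1 ⊗ₜ h))

/-- The description of the Jacobson radical of a crossed product with a cocommutative semisimple
cosemisimple Hopf algebra. -/
theorem jacobson_eq_smash_of_isCocomm [IsAlgClosed F] [IsSemisimpleRing H] [IsCocomm k H]
    (hcoss : IsCosemisimpleCoalgebra k H)
    (hR : JacobsonCommutesWithBaseChange k R F)
    (hA : JacobsonCommutesWithBaseChange k D.Product F) :
    (Ring.jacobson R = D.jacobsonH ∧ D.jacobsonH = D.jacobsonCore) ∧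
      (Ring.jacobson D.Product).restrictScalars k = D.smash D.jacobsonH := by
  have := finite_of_isSemisimpleRing k H
  have := D.base_isScalarTower F
  obtain ⟨hspan, _, hcard⟩ := groupLike_baseChange k H F hcoss
  obtain ⟨e, he⟩ := D.exists_basis F (Module.finBasis k H)
  have hu := D.isCrossedGroupFamily_groupLikeUnit hspan
  have hcard' : IsUnit (Fintype.card (GroupLike F (F ⊗[k] H)) : F ⊗[k] D.Product) := by
    have := hcard.isUnit.map (algebraMap F (F ⊗[k] D.Product))
    rwa [map_natCast] at this
  refine D.jacobson_eq_smash F he (fun x hx i => ?_) (fun s hs => hu.smul_one_mem_jacobson hs) hR hA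
  -- Applied to the regular module; the `S`-linear coordinate map then carries the module radical
  -- into the radical of `F ⊗ R`.
  have h1 := hu.jacobson_le_jacobson hcard' (M := F ⊗[k] D.Product) x hx
  exact Module.le_comap_jacobson (e.coord i) h1

end CrossedSystem

theorem theorem4p12 {k H R F : Type*} [Field k] [Ring H] [HopfAlgebra k H] [Ring R] [Algebra k R]
    (D : CrossedSystem k H R)
    (hss : IsSemisimpleRing H) (hcoss : IsCosemisimpleCoalgebra k H)
    (hcomm : (∀ x y : H, x * y = y * x) ∨ Coalgebra.IsCocomm k H)
    [Field F] [Algebra k F] [IsAlgClosure k F]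
    (hR : JacobsonCommutesWithBaseChange k R F)
    (hA : JacobsonCommutesWithBaseChange k D.Product F) :
    (Ring.jacobson R = D.jacobsonH ∧ D.jacobsonH = D.jacobsonCore) ∧
      (Ring.jacobson D.Product).restrictScalars k = D.smash D.jacobsonH := by
  have := IsAlgClosure.isAlgClosed k (K := F)
  rcases hcomm with hcomm | hcomm
  · let _ : CommRing H := { ‹Ring H› with mul_comm := hcomm }
    exact D.jacobson_eq_smash_of_commRing hcoss hR hA
  · exact D.jacobson_eq_smash_of_isCocomm hcoss hR hA
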